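/- Let $C^2[-1,1]$ be the space of real-valued, twice continuously differentiable functions on $[-1,1]$. For each sign $\nu\in\{+,-\}$ (which we also regard as the number $\pm1$) let $m^\nu\ge 1$ be an integer, let $\alpha_0^\nu,\beta_0^\nu\in\mathbb R$, and for $i=1,\dots,m^\nu$ let $\alpha_i^\nu,\beta_i^\nu\in\mathbb R$ and $\eta_i^\nu\in[-1,1]$ with $\eta_i^\nu\neq \nu 1$. Put $A^\nu=\sum_{i=1}^{m^\nu}|\alpha_i^\nu|$ and $B^\nu=\sum_{i=1}^{m^\nu}|\beta_i^\nu|$, and suppose that, for each $\nu$, $$\alpha_0^\nu\ge 0,\qquad \alpha_0^\nu+|\beta_0^\nu|>0,\qquad \nu\beta_0^\nu\ge 0,\qquad \Big(\frac{A^\nu}{\alpha_0^\nu}\Big)^2+\Big(\frac{B^\nu}{\beta_0^\nu}\Big)^2<1,$$ with the convention that if a denominator is zero then the corresponding numerator must be zero and that fraction is omitted. Consider the eigenvalue problem $$-u''=\lambda u\ \text{ on }(-1,1),\qquad \alpha_0^\nu u(\nu)+\beta_0^\nu u'(\nu)=\sum_{i=1}^{m^\nu}\alpha_i^\nu u(\eta_i^\nu)+\sum_{i=1}^{m^\nu}\beta_i^\nu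 u'(\eta_i^\nu),\quad \nu=\pm1,$$ with $\lambda\in\mathbb R$, $u\in C^2[-1,1]$. An eigenvalue is a $\lambda\in\mathbb R$ for which there is a solution $u\not\equiv0$ (an eigenfunction). For $k\ge0$ let $\lambda_k$ denote the eigenvalue that has exactly $k$ eigenvalues below it (so that the eigenvalues, in increasing order, are $\lambda_0<\lambda_1<\cdots$), and let $\psi_k$ denote any eigenfunction corresponding to $\lambda_k$. Let $\lambda_k^D$ and $\lambda_k^N$, $k\ge0$, denote, with the same numbering, the eigenvalues of $-u''=\lambda u$ on $(-1,1)$ with Dirichlet conditions $u(\pm1)=0$ and Neumann conditions $u'(\pm1)=0$ respectively. For an integer $k\ge0$ let $S_k$ be the set of $u\in C^2[-1,1]$ such that $u(\pm1)\ne0$ and $u$ has exactly $k$ zeros in $(-1,1)$, at each of which $u'\neq0$. Let $T_k$ be the set of $u\in C^2[-1,1]$ such that $u'(\pm1)\neq0$, $u'$ has exactly $k$ zeros in $(-1,1)$, at each of which $u''\ne0$, and $u$ has a zero strictly between any two consecutive zeros of $u'$. Then, for any integer $k_0\ge0$: (a) If, for both $\nu=\pm$, $$\alpha_0^\nu> A^\nu+\lambda^{1/2}B^\nu\qquad\text{with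 }\lambda=\lambda_{k_0}^N,$$ then for every integer $k$ with $0\le k\le k_0-2$ the eigenvalue $\lambda_k$ exists, $\psi_k\in T_{k+1}$, and $\lambda_k^N<\lambda_k<\lambda_{k+2}^N$. (b) If, for both $\nu=\pm$, $$|\beta_0^\nu|>\lambda^{-1/2}A^\nu+B^\nu\qquad\text{with }\lambda=\lambda_{k_0}^D,$$ then for every integer $k\ge k_0+2$ the eigenvalue $\lambda_k$ exists, $\psi_k\in S_k$, and $\lambda_{k-2}^D<\lambda_k<\lambda_k^D$. -/

import Mathlib

open Set

namespace MultiPoint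

noncomputable section

/-- The compact interval `[-1, 1]`. -/
abbrev I : Set ℝ := Icc (-1) 1

/-- The derivative on `[-1, 1]` (one-sided at the end points). -/
def d (u : ℝ → ℝ) : ℝ → ℝ := derivWithin u I

/-- The coefficients of a multi-point boundary condition at one end point. -/
structure BoundaryData where
  m : ℕ
  α₀ : ℝ
  β₀ : ℝ
  α : Fin m → ℝ
  β : Fin m → ℝ
  η : Fin m → ℝ

namespace BoundaryData

/-- The sum of the `|α_i|`, `i = 1, …, m`. -/
def sumα (c : BoundaryData) : ℝ := ∑ i, |c.α i|

/-- The sum of the `|β_i|`, `i = 1, …, m`. -/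
def sumβ (c : BoundaryData) : ℝ := ∑ i, |c.β i|

/-- The standing assumptions on the coefficients of the condition at the end point
`ν ∈ {-1, 1}`. A fraction with zero denominator must have zero numerator and is omitted
(in the last inequality it has the value `0 / 0 = 0`). -/
structure Admissible (c : BoundaryData) (ν : ℝ) : Prop where
  one_le_m : 1 ≤ c.m
  η_mem : ∀ i, c.η i ∈ I
  η_ne : ∀ i, c.η i ≠ ν
  α₀_nonneg : 0 ≤ c.α₀
  α₀_β₀_pos : 0 < c.α₀ + |c.β₀|
  β₀_sign : 0 ≤ ν * c.β₀
  sumα_eq_zero : c.α₀ = 0 → c.sumα = 0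
  sumβ_eq_zero : c.β₀ = 0 → c.sumβ = 0
  sq_lt_one : (c.sumα / c.α₀) ^ 2 + (c.sumβ / c.β₀) ^ 2 < 1

/-- `u` satisfies the multi-point boundary condition at the end point `ν`. -/
def Holds (c : BoundaryData) (ν : ℝ) (u : ℝ → ℝ) : Prop :=
  c.α₀ * u ν + c.β₀ * d u ν = ∑ i, c.α i * u (c.η i) + ∑ i, c.β i * d u (c.η i)

/-- The inequality which prevents `u'` from vanishing at the end point. -/
def DerivNonvanishing (c : BoundaryData) (lam : ℝ) : Prop :=
  c.α₀ > c.sumα + √lam * c.sumβ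

/-- The inequality which prevents `u` from vanishing at the end point. The modulus is needed
because `β₀ ≤ 0` at the end point `-1`. -/
def ValueNonvanishing (c : BoundaryData) (lam : ℝ) : Prop :=
  |c.β₀| > 1 / √lam * c.sumα + c.sumβ

end BoundaryData

/-- The pair of multi-point boundary conditions at `-1` and at `1`. -/
def multiPoint (cminus cplus : BoundaryData) (u : ℝ → ℝ) : Prop :=
  cminus.Holds (-1) u ∧ cplus.Holds 1 u

/-- Dirichlet conditions at both end points. -/
def dirichlet (u : ℝ → ℝ) : Prop := u (-1) = 0 ∧ u 1 = 0

/-- Neumann conditions at both end points. -/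
def neumann (u : ℝ → ℝ) : Prop := d u (-1) = 0 ∧ d u 1 = 0

/-- `u` is an eigenfunction for the value `lam`: a non-trivial solution in `C²[-1, 1]` of
`-u'' = lam u` on `(-1, 1)` that satisfies the boundary conditions `BC`. -/
structure IsEigenfunction (BC : (ℝ → ℝ) → Prop) (lam : ℝ) (u : ℝ → ℝ) : Prop where
  contDiffOn : ContDiffOn ℝ 2 u I
  nontrivial : ∃ x ∈ I, u x ≠ 0
  equation : ∀ x ∈ Ioo (-1 : ℝ) 1, -d (d u) x = lam * u x
  boundary : BC u

/-- The set of (real) eigenvalues. -/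
def spec (BC : (ℝ → ℝ) → Prop) : Set ℝ := {lam | ∃ u, IsEigenfunction BC lam u}

/-- `lam` is the eigenvalue with index `k` in the increasing enumeration of the spectrum,
starting with index `0`: it is an eigenvalue with exactly `k` eigenvalues below it. -/
def IsNthEigenvalue (BC : (ℝ → ℝ) → Prop) (k : ℕ) (lam : ℝ) : Prop :=
  lam ∈ spec BC ∧ (spec BC ∩ Iio lam).encard = k

/-- The eigenvalue with index `k`, as a real number: the infimum of the eigenvalues that have at
least `k` eigenvalues below them. -/
def eigenvalue (BC : (ℝ → ℝ) → Prop) (k : ℕ) : ℝ :=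
  sInf {lam | lam ∈ spec BC ∧ (k : ℕ∞) ≤ (spec BC ∩ Iio lam).encard}

/-- `eigenvalue BC k` is the eigenvalue with index `k` whenever there is one. -/
theorem IsNthEigenvalue.eigenvalue_eq {BC : (ℝ → ℝ) → Prop} {k : ℕ} {lam : ℝ}
    (h : IsNthEigenvalue BC k lam) : eigenvalue BC k = lam := by
  refine IsLeast.csInf_eq ⟨⟨h.1, h.2.ge⟩, ?_⟩
  rintro mu ⟨hmu, hk⟩
  by_contra! hlt
  have hfin : (spec BC ∩ Iio lam).Finite := by
    rw [← Set.encard_lt_top_iff, h.2]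
    exact ENat.natCast_lt_top k
  have hss : spec BC ∩ Iio mu ⊂ spec BC ∩ Iio lam := by
    refine ⟨fun x hx => ⟨hx.1, lt_trans hx.2 hlt⟩, fun hsub => ?_⟩
    exact lt_irrefl mu (hsub ⟨hmu, hlt⟩).2
  have hcard := (hfin.subset hss.subset).encard_lt_encard hss
  rw [h.2] at hcard
  exact absurd hk (not_le.mpr hcard)

/-- The nodal set `S_k^+`. -/
def Splus (k : ℕ) : Set (ℝ → ℝ) :=
  {u | ContDiffOn ℝ 2 u I ∧
    (u (-1) ≠ 0 ∧ u 1 ≠ 0 ∧ 0 < u (-1)) ∧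
    (∀ x ∈ Ioo (-1 : ℝ) 1, u x = 0 → d u x ≠ 0) ∧
    {x | x ∈ Ioo (-1 : ℝ) 1 ∧ u x = 0}.encard = k}

/-- The nodal set `S_k`, the union of `S_k^+` and `S_k^- = -S_k^+`. -/
def S (k : ℕ) : Set (ℝ → ℝ) := Splus k ∪ {u | -u ∈ Splus k}

/-- The nodal set `T_k^+`. -/
def Tplus (k : ℕ) : Set (ℝ → ℝ) :=
  {u | ContDiffOn ℝ 2 u I ∧
    (d u (-1) ≠ 0 ∧ d u 1 ≠ 0 ∧ 0 < d u (-1)) ∧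
    (∀ x ∈ Ioo (-1 : ℝ) 1, d u x = 0 → d (d u) x ≠ 0) ∧
    {x | x ∈ Ioo (-1 : ℝ) 1 ∧ d u x = 0}.encard = k ∧
    (∀ x ∈ Ioo (-1 : ℝ) 1, ∀ y ∈ Ioo (-1 : ℝ) 1, x < y → d u x = 0 → d u y = 0 →
      (∀ z ∈ Ioo x y, d u z ≠ 0) → ∃ z ∈ Ioo x y, u z = 0)}

/-- The nodal set `T_k`, the union of `T_k^+` and `T_k^- = -T_k^+`. -/
def T (k : ℕ) : Set (ℝ → ℝ) := Tplus k ∪ {u | -u ∈ Tplus k}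

end

end MultiPoint

/-! For `λ = s ^ 2 > 0` every solution is a multiple of `sin (s x - τ)`. Inserting it, the condition
at `1` says that the imaginary part of `exp (-iτ) F(s)` vanishes, where `F` is a complex amplitude:
the end point term minus the interior terms. The quadratic hypothesis, by Cauchy-Schwarz, makes the
interior terms smaller in modulus than the end point term for every `s ≥ 0`. Hence `F` never
vanishes, has a continuous argument θ⁺, and the condition becomes `sin (θ⁺ - τ) = 0`. Reflection
turns the condition at `-1` into `sin (θ⁻ + τ) = 0`. Eliminating τ, the eigenfrequencies are the `s`
at which θ⁻ + θ⁺ is a multiple of π.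

The heart of the proof is that the phases increase strictly (`deriv_pos`, `strictMonoOn_phase`), so
each level `(k + 1) π` is attained exactly once. Convexity and energy show that no eigenvalue is
negative and that 0 occurs only when both `α₀` vanish, exactly when the total phase starts at π
(`mem_spec_iff`). Thus `λ_k` is the square of the frequency at level `(k + 1) π`.

Always `θ - s ∈ (-π/2, π)`; Dirichlet has `θ - s = 0` and Neumann `θ - s = π/2`. The hypothesis of
(a) narrows the range to `(-π/2, π/2)`, that of (b) to `(0, π)`. Adding the two ends gives the
eigenvalue bounds, and the same ranges locate the angle `s x - τ` at `x = ±1`, which gives the nodal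
counts. -/

namespace MultiPoint

open Real

/-! ### The boundary condition as a complex amplitude, and its phase -/

namespace BoundaryData

/-- The boundary condition at `-1`, transported to `1` by the reflection `x ↦ -x`. -/
def reflect (c : BoundaryData) : BoundaryData where
  m := c.m
  α₀ := c.α₀
  β₀ := -c.β₀
  α := c.α
  β := fun i => -c.β i
  η := fun i => -c.η i

/-- The scale of the derivative terms. If `α₀ = 0`, all terms carry the same power of the
frequency, which is divided out. -/
noncomputable def scale (c : BoundaryData) (s : ℝ) : ℝ := if c.α₀ = 0 then 1 else s

/-- The complex amplitude of the terms at the end point. -/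
noncomputable def lead (c : BoundaryData) (s : ℝ) : ℂ := ⟨c.α₀, c.scale s * c.β₀⟩

/-- The complex amplitude of the interior terms. -/
noncomputable def inner (c : BoundaryData) (s : ℝ) : ℂ :=
  ∑ i, Complex.exp ((s * c.η i : ℝ) * Complex.I) * ⟨c.α i, c.scale s * c.β i⟩

/-- The complex amplitude of the boundary condition at `1`. -/
noncomputable def amplitude (c : BoundaryData) (s : ℝ) : ℂ :=
  Complex.exp (s * Complex.I) * c.lead s - c.inner s

/-- A continuous argument of the complex amplitude. -/
noncomputable def phase (c : BoundaryData) (s : ℝ) : ℝ :=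
  s + (c.lead s).arg + (c.amplitude s / (Complex.exp (s * Complex.I) * c.lead s)).arg

/-- The defect in the boundary condition at `ν` of the function `x ↦ sin (s x - τ)`. -/
noncomputable def defect (c : BoundaryData) (ν s τ : ℝ) : ℝ :=
  c.α₀ * sin (s * ν - τ) + s * c.β₀ * cos (s * ν - τ)
    - ∑ i, (c.α i * sin (s * c.η i - τ) + s * c.β i * cos (s * c.η i - τ))

variable {c : BoundaryData} {s τ : ℝ}

theorem sumα_nonneg (c : BoundaryData) : 0 ≤ c.sumα := Finset.sum_nonneg fun _ _ => abs_nonneg _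

theorem sumβ_nonneg (c : BoundaryData) : 0 ≤ c.sumβ := Finset.sum_nonneg fun _ _ => abs_nonneg _

theorem sumβ_reflect (c : BoundaryData) : c.reflect.sumβ = c.sumβ :=
  Finset.sum_congr rfl fun _ _ => abs_neg _

theorem Admissible.reflect (h : c.Admissible (-1)) : c.reflect.Admissible 1 where
  one_le_m := h.one_le_m
  η_mem i := by
    have := h.η_mem i
    simp only [BoundaryData.reflect, mem_Icc] at this ⊢
    constructor <;> linarith
  η_ne i hi := h.η_ne i (by simp only [BoundaryData.reflect] at hi; linarith)
  α₀_nonneg := h.α₀_nonneg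
  α₀_β₀_pos := by simpa [BoundaryData.reflect] using h.α₀_β₀_pos
  β₀_sign := by simpa [BoundaryData.reflect] using h.β₀_sign
  sumα_eq_zero := h.sumα_eq_zero
  sumβ_eq_zero h0 := c.sumβ_reflect.trans (h.sumβ_eq_zero (neg_eq_zero.mp h0))
  sq_lt_one := by
    have e : (c.sumβ / -c.β₀) ^ 2 = (c.sumβ / c.β₀) ^ 2 := by rw [div_neg, neg_sq]
    rw [sumβ_reflect]
    change (c.sumα / c.α₀) ^ 2 + (c.sumβ / -c.β₀) ^ 2 < 1
    rw [e]
    exact h.sq_lt_one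

/-- Reflection maps `sin (s x - τ)` to `-sin (s x + τ)`, so the analysis is needed only at the end
point `1`. -/
theorem defect_neg_one (c : BoundaryData) (s τ : ℝ) :
    c.defect (-1) s τ = -c.reflect.defect 1 s (-τ) := by
  have e : ∀ x : ℝ, s * (-x) - (-τ) = -(s * x - τ) := fun x => by ring
  have e1 : s * 1 - (-τ) = -(s * (-1) - τ) := by ring
  have e2 : ∑ i, (c.α i * sin (s * (-c.η i) - (-τ)) + s * (-c.β i) * cos (s * (-c.η i) - (-τ))) =
      -∑ i, (c.α i * sin (s * c.η i - τ) + s * c.β i * cos (s * c.η i - τ)) := by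
    rw [← Finset.sum_neg_distrib]
    refine Finset.sum_congr rfl fun i _ => ?_
    rw [e, sin_neg, cos_neg]; ring
  change _ = -(c.α₀ * sin (s * 1 - (-τ)) + s * (-c.β₀) * cos (s * 1 - (-τ)) -
    ∑ i, (c.α i * sin (s * (-c.η i) - (-τ)) + s * (-c.β i) * cos (s * (-c.η i) - (-τ))))
  rw [e2, e1, sin_neg, cos_neg, defect]
  ring

theorem scale_nonneg (hs : 0 ≤ s) : 0 ≤ c.scale s := by
  unfold scale; split_ifs <;> simp [hs]

theorem scale_pos (hs : 0 < s) : 0 < c.scale s := by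
  unfold scale; split_ifs <;> simp [hs]

theorem Admissible.β₀_nonneg (h : c.Admissible 1) : 0 ≤ c.β₀ := by simpa using h.β₀_sign

/-- Products in place of fractions absorb the convention on zero denominators. -/
theorem Admissible.ratios {ν : ℝ} (h : c.Admissible ν) : ∃ t r : ℝ, 0 ≤ t ∧ 0 ≤ r ∧
    t ^ 2 + r ^ 2 < 1 ∧ c.sumα = t * c.α₀ ∧ c.sumβ = r * |c.β₀| := by
  refine ⟨c.sumα / c.α₀, c.sumβ / |c.β₀|, div_nonneg c.sumα_nonneg h.α₀_nonneg,
    div_nonneg c.sumβ_nonneg (abs_nonneg _), ?_, ?_, ?_⟩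
  · simpa [div_pow] using h.sq_lt_one
  · by_cases h0 : c.α₀ = 0
    · simp [h0, h.sumα_eq_zero h0]
    · field_simp
  · by_cases h0 : c.β₀ = 0
    · simp [h0, h.sumβ_eq_zero h0]
    · have := abs_pos.mpr h0
      field_simp

theorem Admissible.lead_normSq_pos (h : c.Admissible 1) :
    0 < c.α₀ ^ 2 + (c.scale s * c.β₀) ^ 2 := by
  by_cases h0 : c.α₀ = 0
  · have h1 : 0 < |c.β₀| := by simpa [h0] using h.α₀_β₀_pos
    have : c.β₀ ≠ 0 := abs_pos.mp h1
    simp only [scale, h0, if_true]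
    positivity
  · positivity

theorem Admissible.sum_sq_lt (h : c.Admissible 1) :
    (c.sumα + c.scale s * c.sumβ) ^ 2 < c.α₀ ^ 2 + (c.scale s * c.β₀) ^ 2 := by
  obtain ⟨t, r, ht, hr, h1, hα, hβ⟩ := h.ratios
  rw [hα, hβ, abs_of_nonneg h.β₀_nonneg]
  have hN := h.lead_normSq_pos (s := s)
  set b := c.scale s * c.β₀
  have : t * c.α₀ + c.scale s * (r * c.β₀) = t * c.α₀ + r * b := by simp only [b]; ring
  rw [this]
  -- Cauchy-Schwarz: the hinted square is exactly its defect, and `t ^ 2 + r ^ 2 < 1` makes the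
  -- bound strict.
  nlinarith [sq_nonneg (t * b - r * c.α₀)]

/-- The triangle inequality for the complex numbers `p i + q i * I`. -/
theorem sq_sum_add_sq_sum_le {ι : Type*} (t : Finset ι) (p q r : ι → ℝ) (hr : ∀ i, 0 ≤ r i)
    (h : ∀ i, p i ^ 2 + q i ^ 2 ≤ r i ^ 2) :
    (∑ i ∈ t, p i) ^ 2 + (∑ i ∈ t, q i) ^ 2 ≤ (∑ i ∈ t, r i) ^ 2 := by
  have key : ‖∑ i ∈ t, (⟨p i, q i⟩ : ℂ)‖ ≤ ∑ i ∈ t, r i := by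
    refine norm_sum_le_of_le _ fun i _ => ?_
    refine abs_le_of_sq_le_sq' ?_ (hr i) |>.2
    rw [Complex.sq_norm, Complex.normSq_apply]
    nlinarith [h i]
  have := pow_le_pow_left₀ (norm_nonneg _) key 2
  rw [Complex.sq_norm, Complex.normSq_apply] at this
  simpa [Complex.re_sum, Complex.im_sum, sq] using this

theorem exp_mul_re (t a b : ℝ) :
    (Complex.exp (t * Complex.I) * ⟨a, b⟩).re = a * cos t - b * sin t := by
  simp [Complex.exp_ofReal_mul_I_re, Complex.exp_ofReal_mul_I_im]; ring

theorem exp_mul_im (t a b : ℝ) :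
    (Complex.exp (t * Complex.I) * ⟨a, b⟩).im = a * sin t + b * cos t := by
  simp [Complex.exp_ofReal_mul_I_re, Complex.exp_ofReal_mul_I_im]; ring

theorem sum_abs_eq (c : BoundaryData) (r : ℝ) :
    ∑ i, (|c.α i| + r * |c.β i|) = c.sumα + r * c.sumβ := by
  simp [sumα, sumβ, Finset.sum_add_distrib, Finset.mul_sum]

theorem norm_inner_le (hs : 0 ≤ s) : ‖c.inner s‖ ≤ c.sumα + c.scale s * c.sumβ := by
  rw [← sum_abs_eq]
  refine norm_sum_le_of_le _ fun i _ => ?_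
  rw [norm_mul, Complex.norm_exp_ofReal_mul_I, one_mul]
  refine (Complex.norm_le_abs_re_add_abs_im _).trans ?_
  simp [abs_mul, abs_of_nonneg (scale_nonneg (c := c) hs)]

theorem Admissible.norm_inner_lt (h : c.Admissible 1) (hs : 0 ≤ s) :
    ‖c.inner s‖ < ‖Complex.exp (s * Complex.I) * c.lead s‖ := by
  rw [norm_mul, Complex.norm_exp_ofReal_mul_I, one_mul]
  refine (norm_inner_le hs).trans_lt (lt_of_pow_lt_pow_left₀ 2 (norm_nonneg _) ?_)
  rw [Complex.sq_norm, Complex.normSq_apply]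
  simpa [lead, sq] using h.sum_sq_lt

theorem Admissible.lead_ne_zero (h : c.Admissible 1) (hs : 0 ≤ s) : c.lead s ≠ 0 := by
  intro h0
  have := h.norm_inner_lt hs
  rw [h0] at this
  simp at this
  linarith [norm_nonneg (c.inner s)]

/-- The quotient is 1 minus a number of modulus less than 1. In the right half-plane the principal
argument is continuous and of modulus below π/2, which is what makes `phase` a continuous argument.
-/
theorem Admissible.quot_re_pos (h : c.Admissible 1) (hs : 0 ≤ s) :
    0 < (c.amplitude s / (Complex.exp (s * Complex.I) * c.lead s)).re := by
  have hlt := h.norm_inner_lt hs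
  have hne : Complex.exp (s * Complex.I) * c.lead s ≠ 0 := by
    intro h0; rw [h0, norm_zero] at hlt; linarith [norm_nonneg (c.inner s)]
  rw [amplitude, sub_div, div_self hne, Complex.sub_re, Complex.one_re, sub_pos]
  refine (Complex.re_le_norm _).trans_lt ?_
  rwa [norm_div, div_lt_one (norm_pos_iff.mpr hne)]

theorem Admissible.amplitude_ne_zero (h : c.Admissible 1) (hs : 0 ≤ s) : c.amplitude s ≠ 0 := by
  intro h0
  simpa [h0] using h.quot_re_pos hs

theorem Admissible.arg_lead_mem (h : c.Admissible 1) (hs : 0 ≤ s) :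
    0 ≤ (c.lead s).arg ∧ (c.lead s).arg ≤ π / 2 := by
  refine ⟨Complex.arg_nonneg_iff.mpr ?_, ?_⟩
  · exact mul_nonneg (scale_nonneg hs) h.β₀_nonneg
  · exact (abs_le.mp (Complex.abs_arg_le_pi_div_two_iff.mpr h.α₀_nonneg)).2

theorem Admissible.phase_mem (h : c.Admissible 1) (hs : 0 ≤ s) :
    -(π / 2) < c.phase s - s ∧ c.phase s - s < π := by
  have h1 := h.arg_lead_mem hs
  have h2 := abs_lt.mp (Complex.abs_arg_lt_pi_div_two_iff.mpr (Or.inl (h.quot_re_pos hs)))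
  unfold phase
  constructor <;> linarith

theorem Admissible.amplitude_eq (h : c.Admissible 1) (hs : 0 ≤ s) :
    c.amplitude s = ‖c.amplitude s‖ * Complex.exp (c.phase s * Complex.I) := by
  have hl := h.lead_ne_zero hs
  have he := Complex.exp_ne_zero (s * Complex.I)
  have h1 := Complex.norm_mul_exp_arg_mul_I (c.lead s)
  have h2 := Complex.norm_mul_exp_arg_mul_I
    (c.amplitude s / (Complex.exp (s * Complex.I) * c.lead s))
  have h3 : c.amplitude s = Complex.exp (s * Complex.I) * c.lead s *
    (c.amplitude s / (Complex.exp (s * Complex.I) * c.lead s)) := by field_simp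
  have hn : (‖c.lead s‖ : ℂ) ≠ 0 := by simpa using hl
  conv_lhs => rw [h3, ← h2]
  conv_lhs => enter [1, 2]; rw [← h1]
  simp only [norm_div, norm_mul, Complex.norm_exp_ofReal_mul_I, one_mul, phase]
  push_cast
  simp only [add_mul, Complex.exp_add]
  field_simp

theorem Admissible.amplitude_mul_exp (h : c.Admissible 1) (hs : 0 ≤ s) (τ : ℝ) :
    Complex.exp ((-τ : ℝ) * Complex.I) * c.amplitude s =
      ‖c.amplitude s‖ * Complex.exp ((c.phase s - τ : ℝ) * Complex.I) := by
  conv_lhs => rw [h.amplitude_eq hs]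
  rw [mul_left_comm, ← Complex.exp_add]
  congr 2
  push_cast; ring

theorem exp_mul_amplitude (c : BoundaryData) (s τ : ℝ) :
    Complex.exp ((-τ : ℝ) * Complex.I) * c.amplitude s =
      Complex.exp ((s - τ : ℝ) * Complex.I) * ⟨c.α₀, c.scale s * c.β₀⟩ -
      ∑ i, Complex.exp ((s * c.η i - τ : ℝ) * Complex.I) * ⟨c.α i, c.scale s * c.β i⟩ := by
  rw [amplitude, mul_sub, inner, Finset.mul_sum, ← mul_assoc, ← Complex.exp_add, lead]
  congr 1
  · congr 2
    push_cast; ring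
  · refine Finset.sum_congr rfl fun i _ => ?_
    rw [← mul_assoc, ← Complex.exp_add]
    congr 2
    push_cast; ring

/-- The factor `exp (-iτ)` shifts all angles by τ. The imaginary part is then the boundary defect,
up to the factor removed by `scale`; the real part, in `norm_mul_cos`, is minus its τ-derivative. -/
theorem Admissible.norm_mul_sin (h : c.Admissible 1) (hs : 0 ≤ s) (τ : ℝ) :
    ‖c.amplitude s‖ * sin (c.phase s - τ) =
      c.α₀ * sin (s - τ) + c.scale s * c.β₀ * cos (s - τ) -
        ∑ i, (c.α i * sin (s * c.η i - τ) + c.scale s * c.β i * cos (s * c.η i - τ)) := by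
  have := congrArg Complex.im ((h.amplitude_mul_exp hs τ).symm.trans (exp_mul_amplitude c s τ))
  rw [Complex.sub_im, Complex.im_sum, Complex.im_ofReal_mul,
    Complex.exp_ofReal_mul_I_im] at this
  simpa only [exp_mul_im] using this

theorem Admissible.norm_mul_cos (h : c.Admissible 1) (hs : 0 ≤ s) (τ : ℝ) :
    ‖c.amplitude s‖ * cos (c.phase s - τ) =
      c.α₀ * cos (s - τ) - c.scale s * c.β₀ * sin (s - τ) -
        ∑ i, (c.α i * cos (s * c.η i - τ) - c.scale s * c.β i * sin (s * c.η i - τ)) := by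
  have := congrArg Complex.re ((h.amplitude_mul_exp hs τ).symm.trans (exp_mul_amplitude c s τ))
  rw [Complex.sub_re, Complex.re_sum, Complex.re_ofReal_mul,
    Complex.exp_ofReal_mul_I_re] at this
  simpa only [exp_mul_re] using this

theorem α_eq_zero_of_sumα (h : c.sumα = 0) (i : Fin c.m) : c.α i = 0 := by
  simpa using (Finset.sum_eq_zero_iff_of_nonneg (fun _ _ => abs_nonneg _)).mp h i
    (Finset.mem_univ i)

theorem Admissible.defect_eq_zero_iff (h : c.Admissible 1) (hs : 0 < s) :
    c.defect 1 s τ = 0 ↔ sin (c.phase s - τ) = 0 := by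
  have key := h.norm_mul_sin hs.le τ
  have hn : ‖c.amplitude s‖ ≠ 0 := norm_ne_zero_iff.mpr (h.amplitude_ne_zero hs.le)
  -- The extra factor restores the power of `s` that `scale` divides out when `α₀ = 0`.
  have e : c.defect 1 s τ =
      (if c.α₀ = 0 then s else 1) * (‖c.amplitude s‖ * sin (c.phase s - τ)) := by
    rw [key]
    by_cases h0 : c.α₀ = 0
    · have hα := α_eq_zero_of_sumα (h.sumα_eq_zero h0)
      simp [defect, scale, h0, hα, mul_sub, Finset.mul_sum, mul_assoc]
    · simp [defect, scale, h0]
  rw [e]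
  have : (if c.α₀ = 0 then s else 1) ≠ 0 := by split_ifs <;> simp [hs.ne']
  rw [mul_eq_zero_iff_left this, mul_eq_zero_iff_left hn]

theorem abs_sum_trig_le (c : BoundaryData) {r : ℝ} (hr : 0 ≤ r) (f g : Fin c.m → ℝ)
    (hf : ∀ i, |f i| ≤ 1) (hg : ∀ i, |g i| ≤ 1) :
    |∑ i, (c.α i * f i + r * c.β i * g i)| ≤ c.sumα + r * c.sumβ := by
  rw [← sum_abs_eq]
  refine (Finset.abs_sum_le_sum_abs _ _).trans (Finset.sum_le_sum fun i _ => ?_)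
  refine (abs_add_le _ _).trans (add_le_add ?_ ?_)
  · rw [abs_mul]
    exact mul_le_of_le_one_right (abs_nonneg _) (hf i)
  · rw [abs_mul, abs_mul, abs_of_nonneg hr]
    exact mul_le_of_le_one_right (by positivity) (hg i)

/-- With `τ = s` the end point contributes just `α₀` to the cosine identity, which outweighs the
interior terms. So `cos (phase - s) > 0`, which rules out `[π/2, π)`. -/
theorem Admissible.phase_sub_lt_of_deriv (h : c.Admissible 1) (hs : 0 ≤ s)
    (hd : c.sumα + c.scale s * c.sumβ < c.α₀) : c.phase s - s < π / 2 := by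
  have key := h.norm_mul_cos hs s
  have hb := abs_le.mp (abs_sum_trig_le c (scale_nonneg (c := c) hs)
    (fun i => cos (s * c.η i - s)) (fun i => -sin (s * c.η i - s)) (fun i => abs_cos_le_one _)
    (fun i => by rw [abs_neg]; exact abs_sin_le_one _))
  simp only [mul_neg, ← sub_eq_add_neg] at hb
  have hpos : 0 < ‖c.amplitude s‖ * cos (c.phase s - s) := by
    rw [key]; simp only [sub_self, cos_zero, sin_zero]; linarith [hb.2]
  have hc := pos_of_mul_pos_right hpos (norm_nonneg _)
  by_contra! hge
  have := cos_nonpos_of_pi_div_two_le_of_le hge (by linarith [(h.phase_mem hs).2, pi_pos])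
  linarith

/-- The same with the sine identity, where the end point contributes `scale * β₀`; this rules out
`(-π/2, 0]`. -/
theorem Admissible.phase_sub_pos_of_value (h : c.Admissible 1) (hs : 0 ≤ s)
    (hd : c.sumα + c.scale s * c.sumβ < c.scale s * c.β₀) : 0 < c.phase s - s := by
  have key := h.norm_mul_sin hs s
  have hb := abs_le.mp (abs_sum_trig_le c (scale_nonneg (c := c) hs)
    (fun i => sin (s * c.η i - s)) (fun i => cos (s * c.η i - s)) (fun i => abs_sin_le_one _)
    (fun i => abs_cos_le_one _))
  have hpos : 0 < ‖c.amplitude s‖ * sin (c.phase s - s) := by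
    rw [key]; simp only [sub_self, cos_zero, sin_zero]; linarith [hb.2]
  have hc := pos_of_mul_pos_right hpos (norm_nonneg _)
  by_contra! hge
  have := sin_nonpos_of_nonpos_of_neg_pi_le hge (by linarith [(h.phase_mem hs).1, pi_pos])
  linarith

theorem continuous_scale (c : BoundaryData) : Continuous c.scale := by
  by_cases h0 : c.α₀ = 0
  · have : c.scale = fun _ => 1 := by ext; simp [scale, h0]
    rw [this]; exact continuous_const
  · have : c.scale = fun s => s := by ext; simp [scale, h0]
    rw [this]; exact continuous_id

theorem continuous_lead (c : BoundaryData) : Continuous c.lead := by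
  have := c.continuous_scale
  unfold lead
  simp only [Complex.mk_eq_add_mul_I]
  fun_prop

theorem continuous_amplitude (c : BoundaryData) : Continuous c.amplitude := by
  have := c.continuous_scale
  have := c.continuous_lead
  unfold amplitude inner
  simp only [Complex.mk_eq_add_mul_I]
  fun_prop

theorem Admissible.lead_mem_slitPlane (h : c.Admissible 1) (hs : 0 ≤ s) :
    c.lead s ∈ Complex.slitPlane := by
  by_contra hn
  rw [Complex.mem_slitPlane_iff, not_or, not_lt, not_not] at hn
  exact h.lead_ne_zero hs (Complex.ext (le_antisymm hn.1 h.α₀_nonneg) hn.2)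

theorem Admissible.continuousOn_phase (h : c.Admissible 1) : ContinuousOn c.phase (Ici 0) := by
  intro s hs
  have h1 := c.continuous_lead.continuousAt (x := s)
  have h2 := c.continuous_amplitude.continuousAt (x := s)
  have h3 : ContinuousAt (fun s : ℝ => Complex.exp (s * Complex.I) * c.lead s) s :=
    (by fun_prop : Continuous fun s : ℝ => Complex.exp (s * Complex.I)).continuousAt.mul h1
  have h4 := h2.div h3 (mul_ne_zero (Complex.exp_ne_zero _) (h.lead_ne_zero hs))
  refine ContinuousAt.continuousWithinAt ?_
  unfold phase
  refine (continuousAt_id.add (ContinuousAt.comp' (Complex.continuousAt_arg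
    (h.lead_mem_slitPlane hs)) h1)).add (ContinuousAt.comp' (Complex.continuousAt_arg ?_) h4)
  exact Or.inl (h.quot_re_pos hs)

theorem Admissible.phase_zero (h : c.Admissible 1) :
    c.phase 0 = if c.α₀ = 0 then π / 2 else 0 := by
  -- At frequency 0 all terms are real if `α₀ ≠ 0` and all are purely imaginary otherwise, so the
  -- quotient is real.
  have hq : (c.amplitude 0 / (Complex.exp ((0 : ℝ) * Complex.I) * c.lead 0)).arg = 0 := by
    rw [Complex.arg_eq_zero_iff_zero_le]
    refine Complex.nonneg_iff.mpr ⟨(h.quot_re_pos le_rfl).le, ?_⟩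
    by_cases h0 : c.α₀ = 0
    · have hα := α_eq_zero_of_sumα (h.sumα_eq_zero h0)
      simp [amplitude, inner, lead, scale, h0, hα, Complex.mk_eq_add_mul_I, Complex.div_im]
    · simp [amplitude, inner, lead, scale, h0, Complex.mk_eq_add_mul_I, Complex.div_im]
  rw [phase, hq, zero_add, add_zero]
  split_ifs with h0
  · have hb : 0 < |c.β₀| := by simpa [h0] using h.α₀_β₀_pos
    rw [abs_of_nonneg h.β₀_nonneg] at hb
    rw [Complex.arg_eq_pi_div_two_iff]
    simp [lead, scale, h0, hb]
  · rw [Complex.arg_eq_zero_iff_zero_le]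
    refine Complex.nonneg_iff.mpr ⟨h.α₀_nonneg, ?_⟩
    simp [lead, scale, h0]

end BoundaryData

/-! ### Strict monotonicity of the phase -/

namespace BoundaryData

variable {c : BoundaryData} {s τ : ℝ}

/-- Rests on the identity `(a²y - b²x)² + a²b²(x + y)² = (a² + b²)(a²y² + b²x²)`, whose last factor
is at most `a²b²`. It controls the term that comes from differentiating `scale`. -/
theorem sq_mul_sub_sq_mul_le {a b x y t r C : ℝ} (ha : 0 ≤ a) (hb : 0 ≤ b) (hC : 0 ≤ C)
    (hx : |x| ≤ t * a) (hy : |y| ≤ r * b) (htr : t ^ 2 + r ^ 2 ≤ 1)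
    (h : C ^ 2 + (x + y) ^ 2 = a ^ 2 + b ^ 2) : a ^ 2 * y - b ^ 2 * x ≤ a * b * C := by
  have hx2 : x ^ 2 ≤ (t * a) ^ 2 := sq_le_sq' (by linarith [neg_abs_le x]) ((le_abs_self x).trans hx)
  have hy2 : y ^ 2 ≤ (r * b) ^ 2 := sq_le_sq' (by linarith [neg_abs_le y]) ((le_abs_self y).trans hy)
  have h1 : b ^ 2 * x ^ 2 + a ^ 2 * y ^ 2 ≤ a ^ 2 * b ^ 2 := by
    have e1 := mul_le_mul_of_nonneg_left hx2 (sq_nonneg b)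
    have e2 := mul_le_mul_of_nonneg_left hy2 (sq_nonneg a)
    have e3 := mul_le_mul_of_nonneg_left htr (mul_nonneg (sq_nonneg a) (sq_nonneg b))
    nlinarith
  have h2 := mul_le_mul_of_nonneg_left h1 (add_nonneg (sq_nonneg a) (sq_nonneg b))
  have h3 : (a ^ 2 * y - b ^ 2 * x) ^ 2 ≤ (a * b * C) ^ 2 := by
    have e : (a * b * C) ^ 2 = a ^ 2 * b ^ 2 * (a ^ 2 + b ^ 2 - (x + y) ^ 2) := by
      rw [← h]; ring
    rw [e]
    nlinarith
  exact (abs_le_of_sq_le_sq' h3 (by positivity)).2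

/-- The derivative of `scale`. -/
noncomputable def scaleDeriv (c : BoundaryData) : ℝ := if c.α₀ = 0 then 0 else 1

/-- At a zero of the boundary condition in the phase, its derivatives in the frequency and in the
phase have the same sign. -/
theorem Admissible.deriv_pos (h : c.Admissible 1) (hs : 0 < s)
    (hsin : c.α₀ * sin (s - τ) + c.scale s * c.β₀ * cos (s - τ) -
        ∑ i, (c.α i * sin (s * c.η i - τ) + c.scale s * c.β i * cos (s * c.η i - τ)) = 0)
    (hcos : 0 < c.α₀ * cos (s - τ) - c.scale s * c.β₀ * sin (s - τ) -
        ∑ i, (c.α i * cos (s * c.η i - τ) - c.scale s * c.β i * sin (s * c.η i - τ))) :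
    0 < (-(c.scale s * c.β₀)) * sin (s - τ) + (c.α₀ + c.scaleDeriv * c.β₀) * cos (s - τ) -
      ∑ i, ((-(c.η i * (c.scale s * c.β i))) * sin (s * c.η i - τ) +
        (c.η i * c.α i + c.scaleDeriv * c.β i) * cos (s * c.η i - τ)) := by
  have hσ := scale_pos (c := c) hs
  have hN := h.lead_normSq_pos (s := s)
  have hlt := h.sum_sq_lt (s := s)
  obtain ⟨t, r, ht, hr, htr, hA, hB⟩ := h.ratios
  rw [abs_of_nonneg h.β₀_nonneg] at hB
  have ha := h.α₀_nonneg
  have hb : 0 ≤ c.scale s * c.β₀ := mul_nonneg hσ.le h.β₀_nonneg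
  have hx : |∑ i, c.α i * sin (s * c.η i - τ)| ≤ t * c.α₀ := by
    have := abs_sum_trig_le c le_rfl (fun i => sin (s * c.η i - τ)) (fun _ => 0)
      (fun i => abs_sin_le_one _) (by simp)
    simpa [hA] using this
  have hy : |∑ i, c.scale s * c.β i * cos (s * c.η i - τ)| ≤ r * (c.scale s * c.β₀) := by
    have := abs_sum_trig_le { c with α := fun _ => 0 } hσ.le (fun _ => 0)
      (fun i => cos (s * c.η i - τ)) (by simp) (fun i => abs_cos_le_one _)
    have e : r * (c.scale s * c.β₀) = c.scale s * c.sumβ := by rw [hB]; ring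
    rw [e]
    simpa [sumα, sumβ] using this
  -- Each pair of sine and cosine terms is a rotation of `(α i, scale * β i)`; shrinking one
  -- component by `w i` does not increase the modulus. Used with `w = 1` and with `w = η`.
  have hbound : ∀ w : Fin c.m → ℝ, (∀ i, |w i| ≤ 1) →
      (∑ i, w i * (c.α i * cos (s * c.η i - τ) - c.scale s * c.β i * sin (s * c.η i - τ))) ^ 2 +
      (∑ i, (c.α i * sin (s * c.η i - τ) + c.scale s * c.β i * cos (s * c.η i - τ))) ^ 2 <
        c.α₀ ^ 2 + (c.scale s * c.β₀) ^ 2 := by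
    intro w hw
    refine lt_of_le_of_lt ?_ hlt
    rw [← sum_abs_eq]
    refine sq_sum_add_sq_sum_le _ _ _ _ (fun i => by positivity) fun i => ?_
    have hw2 : w i ^ 2 ≤ 1 := by
      rw [← sq_abs]; exact pow_le_one₀ (abs_nonneg _) (hw i)
    have h1 := mul_le_mul_of_nonneg_right hw2
      (sq_nonneg (c.α i * cos (s * c.η i - τ) - c.scale s * c.β i * sin (s * c.η i - τ)))
    have h2 := sin_sq_add_cos_sq (s * c.η i - τ)
    have h3 : (|c.α i| + c.scale s * |c.β i|) ^ 2 = c.α i ^ 2 + (c.scale s * c.β i) ^ 2 +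
        2 * (|c.α i| * (c.scale s * |c.β i|)) := by
      rw [mul_pow, ← sq_abs (c.α i), ← sq_abs (c.β i)]; ring
    have h4 : 0 ≤ |c.α i| * (c.scale s * |c.β i|) := by positivity
    have h5 : (c.α i * cos (s * c.η i - τ) - c.scale s * c.β i * sin (s * c.η i - τ)) ^ 2 +
        (c.α i * sin (s * c.η i - τ) + c.scale s * c.β i * cos (s * c.η i - τ)) ^ 2 =
        c.α i ^ 2 + (c.scale s * c.β i) ^ 2 := by
      linear_combination (c.α i ^ 2 + (c.scale s * c.β i) ^ 2) * h2
    rw [mul_pow, h3]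
    linarith
  have hQ := hbound (fun _ => 1) (by simp)
  have hQη := hbound c.η fun i => abs_le.mpr (h.η_mem i)
  simp only [one_mul] at hQ
  have hCD : (c.α₀ * cos (s - τ) - c.scale s * c.β₀ * sin (s - τ)) ^ 2 +
      (c.α₀ * sin (s - τ) + c.scale s * c.β₀ * cos (s - τ)) ^ 2 =
      c.α₀ ^ 2 + (c.scale s * c.β₀) ^ 2 := by
    linear_combination (c.α₀ ^ 2 + (c.scale s * c.β₀) ^ 2) * sin_sq_add_cos_sq (s - τ)
  have hsplit : ∑ i, (c.α i * sin (s * c.η i - τ) + c.scale s * c.β i * cos (s * c.η i - τ)) =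
      ∑ i, c.α i * sin (s * c.η i - τ) + ∑ i, c.scale s * c.β i * cos (s * c.η i - τ) :=
    Finset.sum_add_distrib
  have hgoal : ∑ i, ((-(c.η i * (c.scale s * c.β i))) * sin (s * c.η i - τ) +
        (c.η i * c.α i + c.scaleDeriv * c.β i) * cos (s * c.η i - τ)) =
      ∑ i, c.η i * (c.α i * cos (s * c.η i - τ) - c.scale s * c.β i * sin (s * c.η i - τ)) +
      c.scaleDeriv * ∑ i, c.β i * cos (s * c.η i - τ) := by
    rw [Finset.mul_sum, ← Finset.sum_add_distrib]
    exact Finset.sum_congr rfl fun i _ => by ring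
  have hyσ : ∑ i, c.scale s * c.β i * cos (s * c.η i - τ) =
      c.scale s * ∑ i, c.β i * cos (s * c.η i - τ) := by
    rw [Finset.mul_sum]
    exact Finset.sum_congr rfl fun i _ => by ring
  rw [hgoal]
  rw [sub_eq_zero] at hsin
  rw [← hsin] at hQ hQη
  rw [hsplit] at hsin
  set C := c.α₀ * cos (s - τ) - c.scale s * c.β₀ * sin (s - τ) with hCdef
  set Q := ∑ i, (c.α i * cos (s * c.η i - τ) - c.scale s * c.β i * sin (s * c.η i - τ))
  set Qη := ∑ i, c.η i * (c.α i * cos (s * c.η i - τ) - c.scale s * c.β i * sin (s * c.η i - τ))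
  set x := ∑ i, c.α i * sin (s * c.η i - τ)
  set y := ∑ i, c.scale s * c.β i * cos (s * c.η i - τ)
  -- The sine parts of the end point and of the interior agree, so `Q ^ 2 < C ^ 2`; together with `C
  -- - Q > 0` this forces `C > 0`. The weighted sum `Qη` then satisfies `|Qη| < C` likewise.
  have hC : 0 < C := by
    by_contra! hC
    nlinarith
  have hCη : 0 < C - Qη := by
    have := abs_lt_of_sq_lt_sq (a := Qη) (b := C) (by linarith) hC.le
    linarith [le_abs_self Qη]
  -- This is the contribution of the derivative of `scale`. Multiplied by the squared modulus of the
  -- leading term, it reduces to `sq_mul_sub_sq_mul_le`.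
  have hrest : 0 ≤ c.scaleDeriv * (c.β₀ * cos (s - τ) - ∑ i, c.β i * cos (s * c.η i - τ)) := by
    by_cases h0 : c.α₀ = 0
    · simp [scaleDeriv, h0]
    · have key := sq_mul_sub_sq_mul_le ha hb hC.le hx hy htr.le (by rw [← hsin]; exact hCD)
      have e : (c.α₀ ^ 2 + (c.scale s * c.β₀) ^ 2) * (c.scale s * c.β₀ * cos (s - τ) - y) =
          c.α₀ * (c.scale s * c.β₀) * C - (c.α₀ ^ 2 * y - (c.scale s * c.β₀) ^ 2 * x) := by
        rw [hCdef]
        linear_combination (c.scale s * c.β₀) ^ 2 * hsin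
      have h1 : 0 ≤ c.scale s * c.β₀ * cos (s - τ) - y :=
        nonneg_of_mul_nonneg_right (by rw [e]; linarith) hN
      rw [hyσ, mul_assoc, ← mul_sub] at h1
      simpa [scaleDeriv, h0] using nonneg_of_mul_nonneg_right h1 hσ
  have e : (-(c.scale s * c.β₀)) * sin (s - τ) + (c.α₀ + c.scaleDeriv * c.β₀) * cos (s - τ) =
      C + c.scaleDeriv * (c.β₀ * cos (s - τ)) := by rw [hCdef]; ring
  rw [e]
  linarith

theorem hasDerivAt_scale (c : BoundaryData) (s : ℝ) : HasDerivAt c.scale c.scaleDeriv s := by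
  by_cases h0 : c.α₀ = 0
  · have : c.scale = fun _ => 1 := by ext; simp [scale, h0]
    rw [this, scaleDeriv, if_pos h0]; exact hasDerivAt_const _ _
  · have : c.scale = fun s => s := by ext; simp [scale, h0]
    rw [this, scaleDeriv, if_neg h0]; exact hasDerivAt_id _

theorem hasDerivAt_exp_mul (c : BoundaryData) (s η a b : ℝ) :
    HasDerivAt (fun s : ℝ => Complex.exp ((s * η : ℝ) * Complex.I) * ⟨a, c.scale s * b⟩)
      (Complex.exp ((s * η : ℝ) * Complex.I) *
        ⟨-(η * (c.scale s * b)), η * a + c.scaleDeriv * b⟩) s := by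
  have h1 : HasDerivAt (fun s : ℝ => Complex.exp ((s * η : ℝ) * Complex.I))
      (Complex.exp ((s * η : ℝ) * Complex.I) * ((η : ℝ) * Complex.I)) s := by
    have := ((hasDerivAt_id s).mul_const η).ofReal_comp.mul_const Complex.I
    simpa using this.cexp
  have h2 : HasDerivAt (fun s : ℝ => (⟨a, c.scale s * b⟩ : ℂ))
      ((c.scaleDeriv * b : ℝ) * Complex.I) s := by
    simp only [Complex.mk_eq_add_mul_I]
    exact ((((c.hasDerivAt_scale s).mul_const b).ofReal_comp.mul_const Complex.I).const_add _)
  refine (h1.mul h2).congr_deriv ?_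
  rw [mul_assoc, ← mul_add]
  congr 1
  apply Complex.ext <;> simp

/-- The derivative of `amplitude`. -/
noncomputable def amplitudeDeriv (c : BoundaryData) (s : ℝ) : ℂ :=
  Complex.exp (s * Complex.I) * ⟨-(c.scale s * c.β₀), c.α₀ + c.scaleDeriv * c.β₀⟩ -
    ∑ i, Complex.exp ((s * c.η i : ℝ) * Complex.I) *
      ⟨-(c.η i * (c.scale s * c.β i)), c.η i * c.α i + c.scaleDeriv * c.β i⟩

theorem hasDerivAt_exp_mul_lead (c : BoundaryData) (s : ℝ) :
    HasDerivAt (fun s : ℝ => Complex.exp (s * Complex.I) * c.lead s)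
      (Complex.exp (s * Complex.I) * ⟨-(c.scale s * c.β₀), c.α₀ + c.scaleDeriv * c.β₀⟩) s := by
  simpa [lead] using c.hasDerivAt_exp_mul s 1 c.α₀ c.β₀

theorem hasDerivAt_amplitude (c : BoundaryData) (s : ℝ) :
    HasDerivAt c.amplitude (c.amplitudeDeriv s) s :=
  (c.hasDerivAt_exp_mul_lead s).sub
    (HasDerivAt.fun_sum fun i _ => c.hasDerivAt_exp_mul s (c.η i) (c.α i) (c.β i))

theorem exp_mul_amplitudeDeriv_im (c : BoundaryData) (s τ : ℝ) :
    (Complex.exp ((-τ : ℝ) * Complex.I) * c.amplitudeDeriv s).im =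
      (-(c.scale s * c.β₀)) * sin (s - τ) + (c.α₀ + c.scaleDeriv * c.β₀) * cos (s - τ) -
      ∑ i, ((-(c.η i * (c.scale s * c.β i))) * sin (s * c.η i - τ) +
        (c.η i * c.α i + c.scaleDeriv * c.β i) * cos (s * c.η i - τ)) := by
  have e : ∀ t : ℝ, ∀ z : ℂ, Complex.exp ((-τ : ℝ) * Complex.I) *
      (Complex.exp (t * Complex.I) * z) = Complex.exp ((t - τ : ℝ) * Complex.I) * z := by
    intro t z
    rw [← mul_assoc, ← Complex.exp_add]
    congr 2
    push_cast; ring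
  rw [amplitudeDeriv, mul_sub, Finset.mul_sum]
  simp only [e, Complex.sub_im, Complex.im_sum, exp_mul_im]

/-- Choose `τ = phase s`: the sine identity then vanishes and the cosine identity equals the
positive modulus, as `deriv_pos` requires. -/
theorem Admissible.logDeriv_amplitude_im_pos (h : c.Admissible 1) (hs : 0 < s) :
    0 < (c.amplitudeDeriv s / c.amplitude s).im := by
  have hn : 0 < ‖c.amplitude s‖ := norm_pos_iff.mpr (h.amplitude_ne_zero hs.le)
  have h1 := h.norm_mul_sin hs.le (c.phase s)
  have h2 := h.norm_mul_cos hs.le (c.phase s)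
  simp only [sub_self, sin_zero, cos_zero, mul_zero, mul_one] at h1 h2
  have h3 := h.deriv_pos hs h1.symm (h2 ▸ hn)
  rw [← exp_mul_amplitudeDeriv_im] at h3
  have e : c.amplitudeDeriv s / c.amplitude s =
      Complex.exp ((-c.phase s : ℝ) * Complex.I) * c.amplitudeDeriv s / ‖c.amplitude s‖ := by
    conv_lhs => rw [h.amplitude_eq hs.le]
    rw [Complex.ofReal_neg, neg_mul, Complex.exp_neg]
    field_simp
  rw [e, Complex.div_ofReal_im]
  exact div_pos h3 hn

/-- The phase is `s` plus the imaginary parts of two logarithms, whose derivatives telescope to the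
logarithmic derivative of the amplitude. -/
theorem Admissible.hasDerivAt_phase (h : c.Admissible 1) (hs : 0 ≤ s) :
    HasDerivAt c.phase (c.amplitudeDeriv s / c.amplitude s).im s := by
  have hl := h.lead_ne_zero hs
  have ha := h.amplitude_ne_zero hs
  have he := Complex.exp_ne_zero (s * Complex.I)
  have him : ∀ {f : ℝ → ℂ} {f' : ℂ}, HasDerivAt f f' s →
      HasDerivAt (fun t => (f t).im) f'.im s :=
    fun hf => Complex.imCLM.hasFDerivAt.comp_hasDerivAt s hf
  have hlead : HasDerivAt c.lead ((c.scaleDeriv * c.β₀ : ℝ) * Complex.I) s := by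
    unfold lead
    simp only [Complex.mk_eq_add_mul_I]
    exact (((c.hasDerivAt_scale s).mul_const _).ofReal_comp.mul_const Complex.I).const_add _
  have h1 := him (hlead.clog_real (h.lead_mem_slitPlane hs))
  have hel : HasDerivAt (fun s : ℝ => Complex.exp (s * Complex.I) * c.lead s)
      (Complex.exp (s * Complex.I) * Complex.I * c.lead s +
        Complex.exp (s * Complex.I) * ((c.scaleDeriv * c.β₀ : ℝ) * Complex.I)) s := by
    have := ((hasDerivAt_id s).ofReal_comp.mul_const Complex.I).cexp
    simp only [id, Complex.ofReal_one, one_mul] at this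
    exact this.mul hlead
  have h2 := him (((c.hasDerivAt_amplitude s).div hel (mul_ne_zero he hl)).clog_real
    (Or.inl (h.quot_re_pos hs)))
  have h3 := ((hasDerivAt_id s).add h1).add h2
  have e : c.phase = (id + fun t => (Complex.log (c.lead t)).im) + fun t =>
      (Complex.log ((c.amplitude / fun s : ℝ => Complex.exp (s * Complex.I) * c.lead s) t)).im := by
    funext t
    simp [phase, Complex.log_im]
  rw [e]
  refine h3.congr_deriv ?_
  have e1 : (1 : ℝ) = Complex.I.im := rfl
  rw [e1, ← Complex.add_im, ← Complex.add_im]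
  congr 1
  simp only [Pi.div_apply]
  field_simp
  ring

theorem Admissible.strictMonoOn_phase (h : c.Admissible 1) : StrictMonoOn c.phase (Ici 0) := by
  refine strictMonoOn_of_deriv_pos (convex_Ici 0) h.continuousOn_phase fun s hs => ?_
  rw [interior_Ici, mem_Ioi] at hs
  rw [(h.hasDerivAt_phase hs.le).deriv]
  exact h.logDeriv_amplitude_im_pos hs

end BoundaryData

/-! ### Solutions of the differential equation as shifted sines -/

section Solutions

variable {BC : (ℝ → ℝ) → Prop} {u : ℝ → ℝ} {lam s τ C : ℝ}

theorem uniqueDiffOn_I : UniqueDiffOn ℝ I := uniqueDiffOn_Icc (by norm_num)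

theorem eqOn_of_hasDerivWithinAt_zero {f : ℝ → ℝ} (h : ∀ x ∈ I, HasDerivWithinAt f 0 I x)
    {x y : ℝ} (hx : x ∈ I) (hy : y ∈ I) : f x = f y := by
  have := (convex_Icc (-1 : ℝ) 1).norm_image_sub_le_of_norm_hasDerivWithin_le (C := 0) h
    (fun x _ => by simp) hx hy
  rw [zero_mul, norm_le_zero_iff, sub_eq_zero] at this
  exact this.symm

theorem contDiffOn_d (h : ContDiffOn ℝ 2 u I) : ContDiffOn ℝ 1 (d u) I :=
  h.derivWithin uniqueDiffOn_I (by norm_num)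

namespace IsEigenfunction

theorem hasDerivWithinAt (h : IsEigenfunction BC lam u) {x : ℝ} (hx : x ∈ I) :
    HasDerivWithinAt u (d u x) I x :=
  (h.contDiffOn.differentiableOn (by norm_num) x hx).hasDerivWithinAt

theorem hasDerivWithinAt_d (h : IsEigenfunction BC lam u) {x : ℝ} (hx : x ∈ I) :
    HasDerivWithinAt (d u) (-(lam * u x)) I x := by
  have h1 := contDiffOn_d h.contDiffOn
  have h2 : ContinuousOn (d (d u)) I := h1.continuousOn_derivWithin uniqueDiffOn_I le_rfl
  have h3 : ContinuousOn (fun x => -(lam * u x)) I :=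
    (continuousOn_const.mul h.contDiffOn.continuousOn).neg
  -- The equation is given on the open interval only; continuity carries it to the end points.
  have h4 : EqOn (d (d u)) (fun x => -(lam * u x)) I := by
    refine EqOn.of_subset_closure (s := Ioo (-1) 1) (fun x hx => ?_) h2 h3 Ioo_subset_Icc_self ?_
    · have := h.equation x hx
      linarith
    · rw [closure_Ioo (by norm_num)]
  have h5 := (h1.differentiableOn one_ne_zero x hx).hasDerivWithinAt
  exact h5.congr_deriv (h4 hx)

theorem exists_eq_sin (h : IsEigenfunction BC (s ^ 2) u) (hs : 0 < s) :
    ∃ C τ : ℝ, C ≠ 0 ∧ EqOn u (fun x => C * sin (s * x - τ)) I := by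
  have hsin : ∀ x, HasDerivWithinAt (fun x => sin (s * x)) (cos (s * x) * s) I x := fun x => by
    simpa using (((hasDerivAt_id x).const_mul s).sin).hasDerivWithinAt
  have hcos : ∀ x, HasDerivWithinAt (fun x => cos (s * x)) (-sin (s * x) * s) I x := fun x => by
    simpa using (((hasDerivAt_id x).const_mul s).cos).hasDerivWithinAt
  have h0 : (0 : ℝ) ∈ I := by simp
  -- The vector `(u, u' / s)`, rotated back by the angle `s x`, is constant; `hp` and `hq` are its
  -- two components.
  have hp : ∀ x ∈ I, u x * cos (s * x) - d u x / s * sin (s * x) = u 0 := fun x hx => by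
    have := eqOn_of_hasDerivWithinAt_zero
      (f := fun x => u x * cos (s * x) - d u x / s * sin (s * x)) (fun x hx => by
        refine (((h.hasDerivWithinAt hx).mul (hcos x)).sub
          (((h.hasDerivWithinAt_d hx).div_const s).mul (hsin x))).congr_deriv ?_
        field_simp
        ring) hx h0
    simpa using this
  have hq : ∀ x ∈ I, u x * sin (s * x) + d u x / s * cos (s * x) = d u 0 / s := fun x hx => by
    have := eqOn_of_hasDerivWithinAt_zero
      (f := fun x => u x * sin (s * x) + d u x / s * cos (s * x)) (fun x hx => by
        refine (((h.hasDerivWithinAt hx).mul (hsin x)).add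
          (((h.hasDerivWithinAt_d hx).div_const s).mul (hcos x))).congr_deriv ?_
        field_simp
        ring) hx h0
    simpa using this
  have key : EqOn u (fun x => ‖(⟨d u 0 / s, -u 0⟩ : ℂ)‖ *
      sin (s * x - (⟨d u 0 / s, -u 0⟩ : ℂ).arg)) I := fun x hx => by
    have e1 := Complex.norm_mul_cos_arg ⟨d u 0 / s, -u 0⟩
    have e2 := Complex.norm_mul_sin_arg ⟨d u 0 / s, -u 0⟩
    simp only at e1 e2 ⊢
    rw [sin_sub]
    linear_combination (-sin (s * x)) * e1 + cos (s * x) * e2 + sin (s * x) * hq x hx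
      + cos (s * x) * hp x hx - u x * sin_sq_add_cos_sq (s * x)
  refine ⟨_, _, ?_, key⟩
  intro hC
  obtain ⟨x, hx, hne⟩ := h.nontrivial
  apply hne
  rw [key hx]
  simp only [hC, zero_mul]

end IsEigenfunction

theorem hasDerivAt_sin_phase (C s τ x : ℝ) :
    HasDerivAt (fun x => C * sin (s * x - τ)) (C * s * cos (s * x - τ)) x := by
  have := ((((hasDerivAt_id x).const_mul s).sub_const τ).sin).const_mul C
  simp only [id, mul_one] at this
  exact this.congr_deriv (by ring)

theorem d_eq_of_eqOn_sin (hu : EqOn u (fun x => C * sin (s * x - τ)) I) :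
    EqOn (d u) (fun x => C * s * cos (s * x - τ)) I := fun x hx => by
  rw [d, derivWithin_congr hu (hu hx)]
  exact (hasDerivAt_sin_phase C s τ x).hasDerivWithinAt.derivWithin (uniqueDiffOn_I x hx)

theorem d_d_eq_of_eqOn_sin (hu : EqOn u (fun x => C * sin (s * x - τ)) I) :
    EqOn (d (d u)) (fun x => -(C * s ^ 2 * sin (s * x - τ))) I := fun x hx => by
  have h1 : EqOn (d u) (fun x => C * s * sin (s * x - (τ - π / 2))) I := fun y hy => by
    rw [d_eq_of_eqOn_sin hu hy]
    simp only
    rw [sub_sub_eq_add_sub, add_sub_right_comm, sin_add_pi_div_two]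
  rw [d_eq_of_eqOn_sin h1 hx]
  simp only
  rw [sub_sub_eq_add_sub, add_sub_right_comm, cos_add_pi_div_two]
  ring

theorem BoundaryData.holds_iff_defect {c : BoundaryData} {ν : ℝ} (hη : ∀ i, c.η i ∈ I)
    (hν : ν ∈ I) (hC : C ≠ 0) (hu : EqOn u (fun x => C * sin (s * x - τ)) I) :
    c.Holds ν u ↔ c.defect ν s τ = 0 := by
  have hd := d_eq_of_eqOn_sin hu
  have e : c.α₀ * u ν + c.β₀ * d u ν - (∑ i, c.α i * u (c.η i) + ∑ i, c.β i * d u (c.η i)) =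
      C * c.defect ν s τ := by
    rw [defect, hu hν, hd hν, ← Finset.sum_add_distrib, mul_sub, Finset.mul_sum]
    congr 1
    · ring
    · refine Finset.sum_congr rfl fun i _ => ?_
      rw [hu (hη i), hd (hη i)]
      ring
  rw [Holds, ← sub_eq_zero, e, mul_eq_zero_iff_left hC]

theorem isEigenfunction_sin (hs : 0 < s) (hBC : BC fun x => sin (s * x - τ)) :
    IsEigenfunction BC (s ^ 2) fun x => sin (s * x - τ) := by
  have hu : EqOn (fun x => sin (s * x - τ)) (fun x => 1 * sin (s * x - τ)) I :=
    fun x _ => by simp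
  refine ⟨by fun_prop, ?_, fun x hx => ?_, hBC⟩
  · by_contra! h
    have h1 := d_eq_of_eqOn_sin hu (x := 0) (by simp)
    have h2 : EqOn (fun x => sin (s * x - τ)) (fun x => 0 * sin (0 * x - 0)) I :=
      fun x hx => by simpa using h x hx
    rw [d_eq_of_eqOn_sin h2 (by simp)] at h1
    have h3 := h 0 (by simp)
    have h4 : cos (s * 0 - τ) = 0 := by simpa [hs.ne'] using h1
    have := sin_sq_add_cos_sq (s * 0 - τ)
    rw [h3, h4] at this
    norm_num at this
  · rw [d_d_eq_of_eqOn_sin hu (Ioo_subset_Icc_self hx)]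
    ring

end Solutions

/-! ### The spectrum in terms of the total phase -/

section Spectrum

open BoundaryData

variable {cm cp : BoundaryData} {s lam : ℝ} {u : ℝ → ℝ}

/-- The total phase, which at the eigenfrequencies is a multiple of `π`. -/
noncomputable def totalPhase (cm cp : BoundaryData) (s : ℝ) : ℝ := cm.reflect.phase s + cp.phase s

theorem multiPoint_sin_iff {C τ : ℝ} (hm : cm.Admissible (-1)) (hp : cp.Admissible 1) (hs : 0 < s)
    (hC : C ≠ 0) (hu : EqOn u (fun x => C * sin (s * x - τ)) I) :
    multiPoint cm cp u ↔ sin (cm.reflect.phase s + τ) = 0 ∧ sin (cp.phase s - τ) = 0 := by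
  rw [multiPoint, holds_iff_defect hm.η_mem (by simp) hC hu,
    holds_iff_defect hp.η_mem (by simp) hC hu, defect_neg_one, neg_eq_zero,
    hm.reflect.defect_eq_zero_iff hs, hp.defect_eq_zero_iff hs, sub_neg_eq_add]

theorem eigenfunction_eq_sin (hm : cm.Admissible (-1)) (hp : cp.Admissible 1) (hs : 0 < s)
    (h : IsEigenfunction (multiPoint cm cp) (s ^ 2) u) :
    sin (totalPhase cm cp s) = 0 ∧
      ∃ C, C ≠ 0 ∧ EqOn u (fun x => C * sin (s * x - cp.phase s)) I := by
  obtain ⟨C, τ, hC, hu⟩ := h.exists_eq_sin hs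
  obtain ⟨h1, h2⟩ := (multiPoint_sin_iff hm hp hs hC hu).mp h.boundary
  constructor
  · have e : totalPhase cm cp s = (cm.reflect.phase s + τ) + (cp.phase s - τ) := by
      rw [totalPhase]; ring
    rw [e, sin_add, h1, h2]
    simp
  -- As `sin (phase - τ) = 0`, the shift τ can be replaced by the phase at the cost of the factor
  -- `cos (phase - τ) = ±1`.
  · refine ⟨C * cos (cp.phase s - τ), mul_ne_zero hC fun h0 => ?_, fun x hx => ?_⟩
    · have := sin_sq_add_cos_sq (cp.phase s - τ)
      rw [h2, h0] at this
      norm_num at this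
    · have e : s * x - τ = (s * x - cp.phase s) + (cp.phase s - τ) := by ring
      rw [hu hx]
      simp only
      rw [e, sin_add, h2]
      ring

theorem sq_mem_spec_iff (hm : cm.Admissible (-1)) (hp : cp.Admissible 1) (hs : 0 < s) :
    s ^ 2 ∈ spec (multiPoint cm cp) ↔ sin (totalPhase cm cp s) = 0 := by
  refine ⟨fun ⟨u, hu⟩ => (eigenfunction_eq_sin hm hp hs hu).1, fun h => ?_⟩
  refine ⟨_, isEigenfunction_sin (τ := cp.phase s) hs ?_⟩
  rw [multiPoint_sin_iff hm hp hs one_ne_zero fun x _ => (one_mul _).symm]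
  exact ⟨h, by simp⟩

/-! ### Non-positive eigenvalues -/

/-- The sign conditions prevent cancellation between the two end point terms, while the interior
terms are at most `t < 1` and `r < 1` times these terms in modulus. -/
theorem BoundaryData.Admissible.eq_zero_of_max {c : BoundaryData} {ν : ℝ} (h : c.Admissible ν)
    (hν : ν ^ 2 = 1) (hu : c.Holds ν u) (h0 : ∀ x ∈ I, |u x| ≤ |u ν|)
    (h1 : ∀ x ∈ I, |d u x| ≤ |d u ν|) (hsign : 0 ≤ ν * (u ν * d u ν)) :
    (c.α₀ ≠ 0 → u ν = 0) ∧ (c.β₀ ≠ 0 → d u ν = 0) := by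
  obtain ⟨t, r, ht, hr, htr, hA, hB⟩ := h.ratios
  have ht1 : t < 1 := by nlinarith
  have hr1 : r < 1 := by nlinarith
  have hprod : 0 ≤ c.α₀ * u ν * (c.β₀ * d u ν) := by
    have := mul_nonneg (mul_nonneg h.α₀_nonneg h.β₀_sign) hsign
    have e : c.α₀ * u ν * (c.β₀ * d u ν) = c.α₀ * (ν * c.β₀) * (ν * (u ν * d u ν)) := by
      linear_combination (-(c.α₀ * c.β₀ * u ν * d u ν)) * hν
    rwa [e]
  have hL : |c.α₀ * u ν + c.β₀ * d u ν| = c.α₀ * |u ν| + |c.β₀| * |d u ν| := by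
    rw [abs_add_eq_add_abs_iff _ _ |>.mpr, abs_mul, abs_mul, abs_of_nonneg h.α₀_nonneg]
    rcases le_total 0 (c.α₀ * u ν) with ha | ha <;> rcases le_total 0 (c.β₀ * d u ν) with hb | hb
    · exact Or.inl ⟨ha, hb⟩
    · rcases (mul_nonneg_iff.mp hprod) with h | h
      · exact Or.inl h
      · exact Or.inr h
    · rcases (mul_nonneg_iff.mp hprod) with h | h
      · exact Or.inl h
      · exact Or.inr h
    · exact Or.inr ⟨ha, hb⟩
  have hR : |∑ i, c.α i * u (c.η i) + ∑ i, c.β i * d u (c.η i)| ≤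
      c.sumα * |u ν| + c.sumβ * |d u ν| := by
    refine (abs_add_le _ _).trans (add_le_add ?_ ?_)
    · rw [sumα, Finset.sum_mul]
      refine (Finset.abs_sum_le_sum_abs _ _).trans (Finset.sum_le_sum fun i _ => ?_)
      rw [abs_mul]
      exact mul_le_mul_of_nonneg_left (h0 _ (h.η_mem i)) (abs_nonneg _)
    · rw [sumβ, Finset.sum_mul]
      refine (Finset.abs_sum_le_sum_abs _ _).trans (Finset.sum_le_sum fun i _ => ?_)
      rw [abs_mul]
      exact mul_le_mul_of_nonneg_left (h1 _ (h.η_mem i)) (abs_nonneg _)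
  rw [← hu, hL, hA, hB] at hR
  have p1 : 0 ≤ (1 - t) * (c.α₀ * |u ν|) :=
    mul_nonneg (by linarith) (mul_nonneg h.α₀_nonneg (abs_nonneg _))
  have p2 : 0 ≤ (1 - r) * (|c.β₀| * |d u ν|) := mul_nonneg (by linarith) (by positivity)
  constructor
  · intro hne
    have : (1 - t) * (c.α₀ * |u ν|) = 0 := by linarith
    simpa [hne, (sub_pos.mpr ht1).ne'] using this
  · intro hne
    have : (1 - r) * (|c.β₀| * |d u ν|) = 0 := by linarith
    simpa [hne, (sub_pos.mpr hr1).ne'] using this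

theorem d_const (x a : ℝ) : d (fun _ => a) x = 0 := by
  simp [d]

namespace IsEigenfunction

variable {BC : (ℝ → ℝ) → Prop}

theorem hasDerivWithinAt_sq (h : IsEigenfunction BC lam u) {x : ℝ} (hx : x ∈ I) :
    HasDerivWithinAt (fun x => u x ^ 2) (2 * (u x * d u x)) I x :=
  ((h.hasDerivWithinAt hx).pow 2).congr_deriv (by simp; ring)

theorem monotoneOn_mul_d (h : IsEigenfunction BC lam u) (hlam : lam ≤ 0) :
    MonotoneOn (fun x => u x * d u x) I := by
  have h1 : ∀ x ∈ I, HasDerivWithinAt (fun x => u x * d u x)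
      (d u x * d u x + u x * -(lam * u x)) I x :=
    fun x hx => (h.hasDerivWithinAt hx).mul (h.hasDerivWithinAt_d hx)
  refine monotoneOn_of_hasDerivWithinAt_nonneg (convex_Icc _ _)
    (fun x hx => (h1 x hx).continuousWithinAt)
    (fun x hx => (h1 x (interior_subset hx)).mono interior_subset) fun x _ => ?_
  nlinarith [mul_self_nonneg (d u x), mul_nonneg (neg_nonneg.mpr hlam) (mul_self_nonneg (u x))]

/-- For `lam ≤ 0` an eigenfunction and its derivative attain their maximal modulus at the same end
point, and there the modulus of the function does not decrease towards the end point. -/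
theorem exists_max (h : IsEigenfunction BC lam u) (hlam : lam ≤ 0) :
    ∃ ν : ℝ, (ν = -1 ∨ ν = 1) ∧ (∀ x ∈ I, |u x| ≤ |u ν|) ∧ (∀ x ∈ I, |d u x| ≤ |d u ν|) ∧
      0 ≤ ν * (u ν * d u ν) := by
  have hm1 : (-1 : ℝ) ∈ I := by simp
  have hp1 : (1 : ℝ) ∈ I := by simp
  have hmono := h.monotoneOn_mul_d hlam
  have hint : interior I = Ioo (-1 : ℝ) 1 := interior_Icc
  have hderiv : ∀ x ∈ Ioo (-1 : ℝ) 1, HasDerivAt (fun x => u x ^ 2) (2 * (u x * d u x)) x :=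
    fun x hx => (h.hasDerivWithinAt_sq (Ioo_subset_Icc_self hx)).hasDerivAt
      (Icc_mem_nhds hx.1 hx.2)
  have hcont : ContinuousOn (fun x => u x ^ 2) I := h.contDiffOn.continuousOn.pow 2
  have hconv : ConvexOn ℝ I fun x => u x ^ 2 := by
    refine MonotoneOn.convexOn_of_deriv (convex_Icc _ _) hcont ?_ ?_
    · rw [hint]
      exact fun x hx => (hderiv x hx).differentiableAt.differentiableWithinAt
    · rw [hint]
      intro x hx y hy hxy
      rw [(hderiv x hx).deriv, (hderiv y hy).deriv]
      exact mul_le_mul_of_nonneg_left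
        (hmono (Ioo_subset_Icc_self hx) (Ioo_subset_Icc_self hy) hxy) (by norm_num)
  -- Conservation of energy: for `lam ≤ 0` a maximum of `u ^ 2` is also one of `(u') ^ 2`.
  have henergy : ∀ x ∈ I, ∀ y ∈ I, d u x ^ 2 + lam * u x ^ 2 = d u y ^ 2 + lam * u y ^ 2 :=
    fun x hx y hy => eqOn_of_hasDerivWithinAt_zero
      (f := fun x => d u x ^ 2 + lam * u x ^ 2) (fun x hx => by
        refine (((h.hasDerivWithinAt_d hx).pow 2).add
          ((h.hasDerivWithinAt_sq hx).const_mul lam)).congr_deriv ?_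
        simp
        ring) hx hy
  have hbound : ∀ ν ∈ I, (∀ x ∈ I, u x ^ 2 ≤ u ν ^ 2) →
      (∀ x ∈ I, |u x| ≤ |u ν|) ∧ (∀ x ∈ I, |d u x| ≤ |d u ν|) := fun ν hν hmax => by
    refine ⟨fun x hx => sq_le_sq.mp (hmax x hx), fun x hx => sq_le_sq.mp ?_⟩
    have h1 := henergy x hx ν hν
    have h2 := mul_le_mul_of_nonpos_left (hmax x hx) hlam
    linarith
  rcases le_total (u (-1) ^ 2) (u 1 ^ 2) with hle | hle
  · obtain ⟨h1, h2⟩ := hbound 1 hp1 fun x hx =>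
      (hconv.le_max_of_mem_Icc hm1 hp1 hx).trans (max_le hle le_rfl)
    refine ⟨1, Or.inr rfl, h1, h2, ?_⟩
    -- `u u'` is monotone, so if negative at `1` it is negative throughout and `u ^ 2` decreases
    -- strictly, against the choice of the end point.
    by_contra! hneg
    have : StrictAntiOn (fun x => u x ^ 2) I := by
      refine strictAntiOn_of_deriv_neg (convex_Icc _ _) hcont fun x hx => ?_
      rw [hint] at hx
      rw [(hderiv x hx).deriv]
      have := hmono (Ioo_subset_Icc_self hx) hp1 hx.2.le
      simp only at this
      linarith
    have := this hm1 hp1 (by norm_num)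
    simp only at this
    linarith
  · obtain ⟨h1, h2⟩ := hbound (-1) hm1 fun x hx =>
      (hconv.le_max_of_mem_Icc hm1 hp1 hx).trans (max_le le_rfl hle)
    refine ⟨-1, Or.inl rfl, h1, h2, ?_⟩
    by_contra! hneg
    have : StrictMonoOn (fun x => u x ^ 2) I := by
      refine strictMonoOn_of_deriv_pos (convex_Icc _ _) hcont fun x hx => ?_
      rw [hint] at hx
      rw [(hderiv x hx).deriv]
      have := hmono hm1 (Ioo_subset_Icc_self hx) hx.1.le
      simp only at this
      linarith
    have := this hm1 hp1 (by norm_num)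
    simp only at this
    linarith

end IsEigenfunction

/-- At the end point of maximal modulus `u ≠ 0` forces `α₀ = 0`, hence `β₀ ≠ 0` and `u' = 0` there.
So `u'` vanishes identically, and the nonzero constant forces `α₀ = 0` at both ends. -/
theorem nonpos_of_mem_spec (hm : cm.Admissible (-1)) (hp : cp.Admissible 1) (hlam : lam ≤ 0)
    (h : lam ∈ spec (multiPoint cm cp)) : lam = 0 ∧ cm.α₀ = 0 ∧ cp.α₀ = 0 := by
  obtain ⟨u, hu⟩ := h
  obtain ⟨ν, hν, hmax, hdmax, hsign⟩ := hu.exists_max hlam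
  have hνI : ν ∈ I := by rcases hν with rfl | rfl <;> simp
  obtain ⟨x₀, hx₀, hne⟩ := hu.nontrivial
  have huν : u ν ≠ 0 := fun h0 => hne (by simpa [h0] using hmax x₀ hx₀)
  have hdν : d u ν = 0 := by
    have aux : ∀ c : BoundaryData, c.Admissible ν → c.Holds ν u → d u ν = 0 := fun c hc hh => by
      obtain ⟨h1, h2⟩ := hc.eq_zero_of_max (by rcases hν with rfl | rfl <;> norm_num) hh hmax hdmax
        hsign
      have hα : c.α₀ = 0 := by
        by_contra hα
        exact huν (h1 hα)
      refine h2 fun hβ => ?_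
      have := hc.α₀_β₀_pos
      simp [hα, hβ] at this
    rcases hν with rfl | rfl
    · exact aux cm hm hu.boundary.1
    · exact aux cp hp hu.boundary.2
  have hd : ∀ x ∈ I, d u x = 0 := fun x hx => by simpa [hdν] using hdmax x hx
  have hconst : ∀ x ∈ I, ∀ y ∈ I, u x = u y := fun x hx y hy =>
    eqOn_of_hasDerivWithinAt_zero
      (fun z hz => (hu.hasDerivWithinAt hz).congr_deriv (hd z hz)) hx hy
  have aux : ∀ c : BoundaryData, ∀ μ : ℝ, μ ∈ I → μ ^ 2 = 1 → c.Admissible μ → c.Holds μ u →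
      c.α₀ = 0 := fun c μ hμ hμ1 hc hh => by
    obtain ⟨h1, -⟩ := hc.eq_zero_of_max hμ1 hh (fun x hx => (hconst x hx μ hμ ▸ le_rfl))
      (fun x hx => by rw [hd x hx, hd μ hμ]) (by rw [hd μ hμ]; simp)
    by_contra hα
    exact huν ((hconst ν hνI μ hμ).trans (h1 hα))
  refine ⟨?_, aux cm (-1) (by simp) (by norm_num) hm hu.boundary.1,
    aux cp 1 (by simp) (by norm_num) hp hu.boundary.2⟩
  have h1 := (hu.hasDerivWithinAt_d hνI).derivWithin (uniqueDiffOn_I ν hνI)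
  rw [derivWithin_congr (f := fun _ => (0 : ℝ)) (fun x hx => hd x hx) (hd ν hνI)] at h1
  simpa [huν] using h1

theorem zero_mem_spec (hm : cm.Admissible (-1)) (hp : cp.Admissible 1) (h1 : cm.α₀ = 0)
    (h2 : cp.α₀ = 0) : 0 ∈ spec (multiPoint cm cp) := by
  have aux : ∀ c : BoundaryData, ∀ ν : ℝ, c.Admissible ν → c.α₀ = 0 → c.Holds ν fun _ => 1 :=
    fun c ν hc h0 => by
      simp [Holds, h0, α_eq_zero_of_sumα (hc.sumα_eq_zero h0), d_const]
  refine ⟨fun _ => 1, contDiffOn_const, ⟨0, by simp, by simp⟩, fun x _ => ?_,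
    aux cm _ hm h1, aux cp _ hp h2⟩
  have e : d (fun _ => (1 : ℝ)) = fun _ => 0 := funext fun x => d_const x 1
  rw [e, d_const]
  simp

/-! ### Enumeration of the eigenvalues by levels of the total phase -/

theorem continuousOn_totalPhase (hm : cm.Admissible (-1)) (hp : cp.Admissible 1) :
    ContinuousOn (totalPhase cm cp) (Ici 0) :=
  hm.reflect.continuousOn_phase.add hp.continuousOn_phase

theorem strictMonoOn_totalPhase (hm : cm.Admissible (-1)) (hp : cp.Admissible 1) :
    StrictMonoOn (totalPhase cm cp) (Ici 0) :=
  hm.reflect.strictMonoOn_phase.add hp.strictMonoOn_phase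

theorem totalPhase_zero (hm : cm.Admissible (-1)) (hp : cp.Admissible 1) :
    totalPhase cm cp 0 = (if cm.α₀ = 0 then π / 2 else 0) + if cp.α₀ = 0 then π / 2 else 0 := by
  rw [totalPhase, hm.reflect.phase_zero, hp.phase_zero]
  rfl

theorem totalPhase_mem (hm : cm.Admissible (-1)) (hp : cp.Admissible 1) (hs : 0 ≤ s) :
    2 * s - π < totalPhase cm cp s ∧ totalPhase cm cp s < 2 * s + 2 * π := by
  have h1 := hm.reflect.phase_mem hs
  have h2 := hp.phase_mem hs
  unfold totalPhase
  constructor <;> linarith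

/-- The total phase starts in `[0, π]`, so positive frequencies meet only positive multiples of π.
It starts at π exactly when both `α₀` vanish, that is, when constants are eigenfunctions. -/
theorem mem_spec_iff (hm : cm.Admissible (-1)) (hp : cp.Admissible 1) :
    lam ∈ spec (multiPoint cm cp) ↔
      ∃ k : ℕ, ∃ s : ℝ, 0 ≤ s ∧ totalPhase cm cp s = (k + 1) * π ∧ lam = s ^ 2 := by
  have h0 := totalPhase_zero hm hp
  constructor
  · intro h
    rcases le_or_gt lam 0 with hlam | hlam
    · obtain ⟨rfl, h1, h2⟩ := nonpos_of_mem_spec hm hp hlam h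
      refine ⟨0, 0, le_rfl, ?_, by norm_num⟩
      rw [h0, if_pos h1, if_pos h2]
      push_cast
      ring
    · have hs := sqrt_pos.mpr hlam
      rw [← sq_sqrt hlam.le, sq_mem_spec_iff hm hp hs, sin_eq_zero_iff] at h
      obtain ⟨n, hn⟩ := h
      have hpos : 0 < totalPhase cm cp √lam := by
        have := strictMonoOn_totalPhase hm hp (mem_Ici.mpr le_rfl) (mem_Ici.mpr hs.le) hs
        have h1 : 0 ≤ totalPhase cm cp 0 := by
          rw [h0]
          have := pi_pos
          split_ifs <;> linarith
        linarith
      rw [← hn] at hpos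
      have hn0 : (0 : ℝ) < n := pos_of_mul_pos_left hpos pi_pos.le
      have hn1 : 0 < n := by exact_mod_cast hn0
      refine ⟨(n - 1).toNat, √lam, hs.le, ?_, (sq_sqrt hlam.le).symm⟩
      rw [← hn]
      congr 1
      have : (((n - 1).toNat : ℤ) : ℝ) = ((n - 1 : ℤ) : ℝ) := by
        rw [Int.toNat_of_nonneg (by lia)]
      push_cast at this
      rw [this]
      ring
  · rintro ⟨k, s, hs, hk, rfl⟩
    rcases hs.eq_or_lt with rfl | hs
    · have hkpi : π ≤ (k + 1) * π := by nlinarith [pi_pos, (Nat.cast_nonneg k : (0 : ℝ) ≤ k)]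
      rw [← hk, h0] at hkpi
      have hpi := pi_pos
      rw [zero_pow two_ne_zero]
      refine zero_mem_spec hm hp ?_ ?_ <;> by_contra hne <;> rw [if_neg hne] at hkpi <;>
        split_ifs at hkpi <;> linarith
    · rw [sq_mem_spec_iff hm hp hs, hk]
      exact_mod_cast sin_nat_mul_pi (k + 1)

theorem exists_totalPhase_eq (hm : cm.Admissible (-1)) (hp : cp.Admissible 1) (k : ℕ) :
    ∃ s : ℝ, 0 ≤ s ∧ totalPhase cm cp s = (k + 1) * π := by
  have hpi := pi_pos
  have hk : (0 : ℝ) ≤ k := Nat.cast_nonneg k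
  -- At this frequency the lower bound `2 s - π` equals the level `(k + 1) π`.
  have hM : 0 ≤ ((k : ℝ) + 2) * π / 2 := by positivity
  have hmem : ((k : ℝ) + 1) * π ∈
      Icc (totalPhase cm cp 0) (totalPhase cm cp (((k : ℝ) + 2) * π / 2)) := by
    constructor
    · rw [totalPhase_zero hm hp]
      have : 0 ≤ k * π := by positivity
      split_ifs <;> linarith
    · linarith [(totalPhase_mem hm hp hM).1]
  obtain ⟨s, hs, h⟩ := intermediate_value_Icc hM
    ((continuousOn_totalPhase hm hp).mono Icc_subset_Ici_self) hmem
  exact ⟨s, hs.1, h⟩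

theorem isNthEigenvalue_of_totalPhase (hm : cm.Admissible (-1)) (hp : cp.Admissible 1) {k : ℕ}
    (hs : 0 ≤ s) (hk : totalPhase cm cp s = (k + 1) * π) :
    IsNthEigenvalue (multiPoint cm cp) k (s ^ 2) := by
  refine ⟨(mem_spec_iff hm hp).mpr ⟨k, s, hs, hk, rfl⟩, ?_⟩
  have hmono := strictMonoOn_totalPhase hm hp
  choose f hf0 hf using exists_totalPhase_eq hm hp
  have hlt : ∀ {t t' : ℝ} {j j' : ℕ}, 0 ≤ t → 0 ≤ t' → totalPhase cm cp t = (j + 1) * π →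
      totalPhase cm cp t' = (j' + 1) * π → (t ^ 2 < t' ^ 2 ↔ j < j') := by
    intro t t' j j' ht ht' hj hj'
    rw [sq_lt_sq₀ ht ht', ← hmono.lt_iff_lt ht ht', hj, hj', mul_lt_mul_iff_left₀ pi_pos]
    simp
  have e : spec (multiPoint cm cp) ∩ Iio (s ^ 2) = (fun j => f j ^ 2) '' Iio k := by
    ext mu
    constructor
    · rintro ⟨h1, h2⟩
      obtain ⟨j, t, ht, hj, rfl⟩ := (mem_spec_iff hm hp).mp h1
      refine ⟨j, (hlt ht hs hj hk).mp h2, ?_⟩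
      have : f j = t := hmono.injOn (hf0 j) ht ((hf j).trans hj.symm)
      simp only [this]
    · rintro ⟨j, hj, rfl⟩
      exact ⟨(mem_spec_iff hm hp).mpr ⟨j, f j, hf0 j, hf j, rfl⟩, (hlt (hf0 j) hs (hf j) hk).mpr hj⟩
  have hinj : Function.Injective fun j => f j ^ 2 := by
    intro i j hij
    by_contra hne
    rcases lt_or_gt_of_ne hne with h | h
    · exact ((hlt (hf0 i) (hf0 j) (hf i) (hf j)).mpr h).ne hij
    · exact ((hlt (hf0 j) (hf0 i) (hf j) (hf i)).mpr h).ne hij.symm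
  rw [e, hinj.encard_image, ← Finset.coe_Iio, Set.encard_coe_eq_coe_finsetCard, Nat.card_Iio]

/-! ### The Dirichlet and Neumann spectra as special cases -/

/-- The Dirichlet condition as a multi-point condition. -/
def dirichletData : BoundaryData := ⟨1, 1, 0, fun _ => 0, fun _ => 0, fun _ => 0⟩

/-- The Neumann condition at `ν` as a multi-point condition. -/
def neumannData (ν : ℝ) : BoundaryData := ⟨1, 0, ν, fun _ => 0, fun _ => 0, fun _ => 0⟩

theorem admissible_dirichletData {ν : ℝ} (hν : ν ≠ 0) : dirichletData.Admissible ν := by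
  constructor <;> simp [dirichletData, sumα, sumβ, hν.symm]

theorem admissible_neumannData {ν : ℝ} (hν : ν ≠ 0) : (neumannData ν).Admissible ν := by
  constructor <;> simp [neumannData, sumα, sumβ, hν, hν.symm, mul_self_nonneg]

theorem phase_of_inner_eq_zero {c : BoundaryData} (h : c.Admissible 1) (hs : 0 ≤ s)
    (h0 : c.inner s = 0) : c.phase s = s + (c.lead s).arg := by
  rw [phase, amplitude, h0, sub_zero,
    div_self (mul_ne_zero (Complex.exp_ne_zero _) (h.lead_ne_zero hs)), Complex.arg_one, add_zero]

theorem totalPhase_dirichlet (hs : 0 ≤ s) : totalPhase dirichletData dirichletData s = 2 * s := by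
  have h1 := admissible_dirichletData (ν := 1) (by norm_num)
  have h2 := admissible_dirichletData (ν := -1) (by norm_num)
  have e0 : (⟨1, 0⟩ : ℂ) = 1 := rfl
  rw [totalPhase, phase_of_inner_eq_zero h1 hs, phase_of_inner_eq_zero h2.reflect hs]
  · simp [lead, scale, dirichletData, BoundaryData.reflect, e0]
    ring
  all_goals
    refine Finset.sum_eq_zero fun i _ => ?_
    simp [scale, dirichletData, BoundaryData.reflect, Complex.mk_eq_add_mul_I]

theorem totalPhase_neumann (hs : 0 ≤ s) :
    totalPhase (neumannData (-1)) (neumannData 1) s = 2 * s + π := by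
  have h1 := admissible_neumannData (ν := 1) (by norm_num)
  have h2 := admissible_neumannData (ν := -1) (by norm_num)
  have e0 : (⟨0, 1⟩ : ℂ) = Complex.I := rfl
  rw [totalPhase, phase_of_inner_eq_zero h1 hs, phase_of_inner_eq_zero h2.reflect hs]
  · simp [lead, scale, neumannData, BoundaryData.reflect, e0]
    ring
  all_goals
    refine Finset.sum_eq_zero fun i _ => ?_
    simp [scale, neumannData, BoundaryData.reflect, Complex.mk_eq_add_mul_I]

theorem multiPoint_dirichletData : multiPoint dirichletData dirichletData = dirichlet := by
  ext u
  simp [multiPoint, dirichlet, Holds, dirichletData]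

theorem multiPoint_neumannData : multiPoint (neumannData (-1)) (neumannData 1) = neumann := by
  ext u
  simp [multiPoint, neumann, Holds, neumannData]

theorem eigenvalue_dirichlet (k : ℕ) : eigenvalue dirichlet k = ((k + 1) * π / 2) ^ 2 := by
  have hs : 0 ≤ ((k : ℝ) + 1) * π / 2 := by positivity
  rw [← multiPoint_dirichletData]
  refine (isNthEigenvalue_of_totalPhase (admissible_dirichletData (by norm_num))
    (admissible_dirichletData (by norm_num)) hs ?_).eigenvalue_eq
  rw [totalPhase_dirichlet hs]
  ring

theorem eigenvalue_neumann (k : ℕ) : eigenvalue neumann k = (k * π / 2) ^ 2 := by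
  have hs : 0 ≤ (k : ℝ) * π / 2 := by positivity
  rw [← multiPoint_neumannData]
  refine (isNthEigenvalue_of_totalPhase (admissible_neumannData (by norm_num))
    (admissible_neumannData (by norm_num)) hs ?_).eigenvalue_eq
  rw [totalPhase_neumann hs]
  ring

end Spectrum

/-! ### Nodal properties of shifted sines -/

section Nodal

variable {u : ℝ → ℝ} {s τ C : ℝ} {n : ℕ}

/-- The angle `s x - τ` increases from `(-(n + 1) π, -n π)` into `(-π, 0)`, crossing exactly `-n π,
…, -π`. -/
theorem encard_sin_zeros (hs : 0 < s) (hl : -((n + 1) * π) < s * (-1) - τ)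
    (hl' : s * (-1) - τ < -(n * π)) (hr : -π < s * 1 - τ) (hr' : s * 1 - τ < 0) :
    {x | x ∈ Ioo (-1 : ℝ) 1 ∧ sin (s * x - τ) = 0}.encard = n := by
  have hpi := pi_pos
  have e : {x | x ∈ Ioo (-1 : ℝ) 1 ∧ sin (s * x - τ) = 0} =
      (fun j : ℕ => (τ - (j + 1) * π) / s) '' Iio n := by
    ext x
    constructor
    · rintro ⟨⟨h1, h2⟩, h0⟩
      obtain ⟨m, hm⟩ := sin_eq_zero_iff.mp h0
      have b1 := mul_lt_mul_of_pos_left h1 hs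
      have b2 := mul_lt_mul_of_pos_left h2 hs
      have c1 : (-(n + 1) : ℝ) < m := by
        by_contra! h
        nlinarith
      have c2 : (m : ℝ) < 0 := by
        by_contra! h
        nlinarith
      have c1' : -((n : ℤ) + 1) < m := by exact_mod_cast c1
      have c2' : m < 0 := by exact_mod_cast c2
      have e1 : (((-m - 1).toNat : ℤ) : ℝ) = ((-m - 1 : ℤ) : ℝ) := by
        rw [Int.toNat_of_nonneg (by lia)]
      push_cast at e1
      refine ⟨(-m - 1).toNat, by simp only [mem_Iio]; lia, ?_⟩
      simp only [e1]
      rw [div_eq_iff hs.ne']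
      linear_combination hm
    · rintro ⟨j, hj, rfl⟩
      have hj1 : (j : ℝ) + 1 ≤ n := by exact_mod_cast hj
      have hj2 := mul_le_mul_of_nonneg_right hj1 hpi.le
      have hj3 : 0 ≤ (j : ℝ) * π := by positivity
      refine ⟨⟨?_, ?_⟩, ?_⟩
      · rw [lt_div_iff₀ hs]
        linarith
      · rw [div_lt_iff₀ hs]
        linarith
      · have e1 : s * ((τ - ((j : ℝ) + 1) * π) / s) - τ = -(((j + 1 : ℕ) : ℝ) * π) := by
          field_simp
          push_cast
          ring
        simp only [e1]
        rw [sin_neg, sin_nat_mul_pi, neg_zero]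
  have hinj : Function.Injective fun j : ℕ => (τ - (j + 1) * π) / s := by
    intro i j hij
    have h1 : τ - ((i : ℝ) + 1) * π = τ - ((j : ℝ) + 1) * π := by
      simpa [hs.ne'] using hij
    have h2 : (i : ℝ) * π = j * π := by linarith
    exact_mod_cast mul_right_cancel₀ hpi.ne' h2
  rw [e, hinj.encard_image, ← Finset.coe_Iio, Set.encard_coe_eq_coe_finsetCard, Nat.card_Iio]

theorem sin_ne_zero_of_mem {x : ℝ} {n : ℕ} (h1 : -((n + 1) * π) < x) (h2 : x < -(n * π)) :
    sin x ≠ 0 := by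
  intro h0
  obtain ⟨m, rfl⟩ := sin_eq_zero_iff.mp h0
  have hpi := pi_pos
  have c1 : (-(n + 1) : ℝ) < m := by
    by_contra! h
    nlinarith
  have c2 : (m : ℝ) < -n := by
    by_contra! h
    nlinarith
  have c1' : -((n : ℤ) + 1) < m := by exact_mod_cast c1
  have c2' : m < -(n : ℤ) := by exact_mod_cast c2
  lia

theorem cos_ne_zero_of_sin_eq_zero {x : ℝ} (h : sin x = 0) : cos x ≠ 0 := fun h0 => by
  have := sin_sq_add_cos_sq x
  rw [h, h0] at this
  norm_num at this

theorem mem_Splus_of_eqOn_sin (hs : 0 < s) (hC : C ≠ 0) (hreg : ContDiffOn ℝ 2 u I)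
    (hu : EqOn u (fun x => C * sin (s * x - τ)) I) (hl : -((n + 1) * π) < s * (-1) - τ)
    (hl' : s * (-1) - τ < -(n * π)) (hr : -π < s * 1 - τ) (hr' : s * 1 - τ < 0)
    (hpos : 0 < u (-1)) : u ∈ Splus n := by
  refine ⟨hreg, ⟨hpos.ne', ?_, hpos⟩, fun x hx h0 => ?_, ?_⟩
  · rw [hu (by simp)]
    exact mul_ne_zero hC (sin_ne_zero_of_mem (n := 0) (by simpa using hr) (by simpa using hr'))
  · rw [hu (Ioo_subset_Icc_self hx), mul_eq_zero_iff_left hC] at h0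
    rw [d_eq_of_eqOn_sin hu (Ioo_subset_Icc_self hx)]
    exact mul_ne_zero (mul_ne_zero hC hs.ne') (cos_ne_zero_of_sin_eq_zero h0)
  · rw [← encard_sin_zeros hs hl hl' hr hr']
    congr 1
    ext x
    refine and_congr_right fun hx => ?_
    rw [hu (Ioo_subset_Icc_self hx), mul_eq_zero_iff_left hC]

theorem mem_S_of_eqOn_sin (hs : 0 < s) (hC : C ≠ 0) (hreg : ContDiffOn ℝ 2 u I)
    (hu : EqOn u (fun x => C * sin (s * x - τ)) I) (hl : -((n + 1) * π) < s * (-1) - τ)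
    (hl' : s * (-1) - τ < -(n * π)) (hr : -π < s * 1 - τ) (hr' : s * 1 - τ < 0) : u ∈ S n := by
  have hne : u (-1) ≠ 0 := by
    rw [hu (by simp)]
    exact mul_ne_zero hC (sin_ne_zero_of_mem hl hl')
  rcases hne.lt_or_gt with h | h
  · refine Or.inr (mem_Splus_of_eqOn_sin hs (neg_ne_zero.mpr hC) hreg.neg (fun x hx => ?_)
      hl hl' hr hr' (neg_pos.mpr h))
    simp [hu hx]
  · exact Or.inl (mem_Splus_of_eqOn_sin hs hC hreg hu hl hl' hr hr' h)

theorem mem_Tplus_of_eqOn_sin (hs : 0 < s) (hC : C ≠ 0) (hreg : ContDiffOn ℝ 2 u I)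
    (hu : EqOn u (fun x => C * sin (s * x - τ)) I)
    (hl : -((n + 1) * π) < s * (-1) - (τ + π / 2))
    (hl' : s * (-1) - (τ + π / 2) < -(n * π)) (hr : -π < s * 1 - (τ + π / 2))
    (hr' : s * 1 - (τ + π / 2) < 0) (hpos : 0 < d u (-1)) : u ∈ Tplus n := by
  have hCs : C * s ≠ 0 := mul_ne_zero hC hs.ne'
  -- The derivative is a sine with shift `τ + π / 2`, so the zero count for sines applies to it.
  have hd : ∀ x ∈ I, d u x = 0 ↔ sin (s * x - (τ + π / 2)) = 0 := fun x hx => by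
    rw [d_eq_of_eqOn_sin hu hx, mul_eq_zero_iff_left hCs, ← sub_sub, sin_sub_pi_div_two,
      neg_eq_zero]
  refine ⟨hreg, ⟨hpos.ne', ?_, hpos⟩, fun x hx h0 => ?_, ?_, fun x hx y hy hxy h1 h2 _ => ?_⟩
  · rw [Ne, hd 1 (by simp)]
    exact sin_ne_zero_of_mem (n := 0) (by simpa using hr) (by simpa using hr')
  · have hx' := Ioo_subset_Icc_self hx
    have h1 := cos_ne_zero_of_sin_eq_zero ((hd x hx').mp h0)
    rw [← sub_sub, cos_sub_pi_div_two] at h1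
    rw [d_d_eq_of_eqOn_sin hu hx']
    exact neg_ne_zero.mpr (mul_ne_zero (mul_ne_zero hC (pow_ne_zero 2 hs.ne')) h1)
  · rw [← encard_sin_zeros hs hl hl' hr hr']
    congr 1
    ext x
    exact and_congr_right fun hx => hd x (Ioo_subset_Icc_self hx)
  · obtain ⟨m, hm⟩ := sin_eq_zero_iff.mp ((hd x (Ioo_subset_Icc_self hx)).mp h1)
    obtain ⟨m', hm'⟩ := sin_eq_zero_iff.mp ((hd y (Ioo_subset_Icc_self hy)).mp h2)
    have hpi := pi_pos
    have hsxy := mul_lt_mul_of_pos_left hxy hs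
    have hmm : (m : ℝ) < m' := by
      by_contra! h
      nlinarith
    have hmm' : (m : ℝ) + 1 ≤ m' := by
      have : m < m' := by exact_mod_cast hmm
      exact_mod_cast this
    have h3 := mul_le_mul_of_nonneg_right hmm' hpi.le
    -- A quarter period after a zero of `u'` lies a zero of `u`; the next zero of `u'` is at least
    -- half a period away.
    have hz : x + π / 2 / s ∈ Ioo x y := by
      refine ⟨by linarith [(by positivity : 0 < π / 2 / s)], ?_⟩
      rw [← lt_sub_iff_add_lt', div_lt_iff₀ hs]
      linarith
    refine ⟨_, hz, ?_⟩
    rw [hu ⟨(hx.1.trans hz.1).le, (hz.2.trans hy.2).le⟩]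
    have e : s * (x + π / 2 / s) - τ = ((m + 1 : ℤ) : ℝ) * π := by
      push_cast
      field_simp
      linear_combination (-2) * hm
    simp only [e]
    rw [sin_int_mul_pi, mul_zero]

theorem mem_T_of_eqOn_sin (hs : 0 < s) (hC : C ≠ 0) (hreg : ContDiffOn ℝ 2 u I)
    (hu : EqOn u (fun x => C * sin (s * x - τ)) I)
    (hl : -((n + 1) * π) < s * (-1) - (τ + π / 2))
    (hl' : s * (-1) - (τ + π / 2) < -(n * π)) (hr : -π < s * 1 - (τ + π / 2))
    (hr' : s * 1 - (τ + π / 2) < 0) : u ∈ T n := by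
  have hu' : EqOn (-u) (fun x => -C * sin (s * x - τ)) I := fun x hx => by simp [hu hx]
  have hne : d u (-1) ≠ 0 := by
    have := sin_ne_zero_of_mem hl hl'
    rw [← sub_sub, sin_sub_pi_div_two, neg_ne_zero] at this
    rw [d_eq_of_eqOn_sin hu (by simp)]
    exact mul_ne_zero (mul_ne_zero hC hs.ne') this
  rcases hne.lt_or_gt with h | h
  · refine Or.inr (mem_Tplus_of_eqOn_sin hs (neg_ne_zero.mpr hC) hreg.neg hu' hl hl' hr hr' ?_)
    rw [d_eq_of_eqOn_sin hu (by simp)] at h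
    rw [d_eq_of_eqOn_sin hu' (by simp)]
    simp only at h ⊢
    linarith
  · exact Or.inl (mem_Tplus_of_eqOn_sin hs hC hreg hu hl hl' hr hr' h)

end Nodal

/-! ### Phase ranges under the nonvanishing conditions -/

namespace BoundaryData

variable {c : BoundaryData} {s r : ℝ}

theorem derivNonvanishing_reflect : c.reflect.DerivNonvanishing r ↔ c.DerivNonvanishing r := by
  rw [DerivNonvanishing, sumβ_reflect]
  rfl

theorem valueNonvanishing_reflect : c.reflect.ValueNonvanishing r ↔ c.ValueNonvanishing r := by
  have e : |c.reflect.β₀| = |c.β₀| := abs_neg _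
  rw [ValueNonvanishing, sumβ_reflect, e]
  rfl

theorem Admissible.phase_mem_of_deriv (h : c.Admissible 1) (hs : 0 ≤ s) (hsr : s ≤ r)
    (hd : c.DerivNonvanishing (r ^ 2)) : -(π / 2) < c.phase s - s ∧ c.phase s - s < π / 2 := by
  refine ⟨(h.phase_mem hs).1, h.phase_sub_lt_of_deriv hs ?_⟩
  rw [DerivNonvanishing, sqrt_sq (hs.trans hsr)] at hd
  have hpos : c.α₀ ≠ 0 := by
    have := mul_nonneg (hs.trans hsr) c.sumβ_nonneg
    have := c.sumα_nonneg
    exact ne_of_gt (by linarith)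
  have := mul_le_mul_of_nonneg_right hsr c.sumβ_nonneg
  rw [scale, if_neg hpos]
  linarith

theorem Admissible.phase_mem_of_value (h : c.Admissible 1) (hr : 0 < r) (hsr : r ≤ s)
    (hd : c.ValueNonvanishing (r ^ 2)) : 0 < c.phase s - s ∧ c.phase s - s < π := by
  have hs := hr.le.trans hsr
  refine ⟨h.phase_sub_pos_of_value hs ?_, (h.phase_mem hs).2⟩
  rw [ValueNonvanishing, sqrt_sq hr.le, abs_of_nonneg h.β₀_nonneg] at hd
  by_cases h0 : c.α₀ = 0
  · rw [h.sumα_eq_zero h0] at hd ⊢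
    rw [scale, if_pos h0]
    linarith
  · rw [scale, if_neg h0]
    have h1 := mul_lt_mul_of_pos_left hd hr
    have h2 : r * (1 / r * c.sumα + c.sumβ) = c.sumα + r * c.sumβ := by field_simp
    -- Since `β₀ ≥ sumβ`, the inequality at frequency `r` persists for all `s ≥ r`.
    have h3 : 0 ≤ c.β₀ - c.sumβ := by
      have : 0 ≤ 1 / r * c.sumα := mul_nonneg (by positivity) c.sumα_nonneg
      linarith
    have h4 := mul_le_mul_of_nonneg_right hsr h3
    nlinarith

end BoundaryData

/-! ### The two halves of the theorem -/

/-- The lower part of the spectrum, where the derivative does not vanish at the end points. -/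
theorem nthEigenvalue_of_derivNonvanishing (cminus cplus : BoundaryData)
    (hminus : cminus.Admissible (-1)) (hplus : cplus.Admissible 1) (k₀ : ℕ)
    (hm : cminus.DerivNonvanishing (eigenvalue neumann k₀))
    (hp : cplus.DerivNonvanishing (eigenvalue neumann k₀)) (k : ℕ) (hk : k + 2 ≤ k₀) :
    ∃ lam : ℝ, IsNthEigenvalue (multiPoint cminus cplus) k lam ∧
      (∀ ψ : ℝ → ℝ, IsEigenfunction (multiPoint cminus cplus) lam ψ → ψ ∈ T (k + 1)) ∧
      eigenvalue neumann k < lam ∧ lam < eigenvalue neumann (k + 2) := by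
  have hpi := pi_pos
  have hk0 : (0 : ℝ) ≤ k * π := by positivity
  obtain ⟨s, hs, hsk⟩ := exists_totalPhase_eq hminus hplus k
  rw [eigenvalue_neumann] at hm hp
  rw [eigenvalue_neumann, eigenvalue_neumann]
  have hr : 0 ≤ (k₀ : ℝ) * π / 2 := by positivity
  have hkk : ((k : ℝ) + 2) * π ≤ k₀ * π :=
    mul_le_mul_of_nonneg_right (by exact_mod_cast hk) hpi.le
  -- Here `k + 2 ≤ k₀` enters: at `k₀ π / 2` the total phase already exceeds `(k₀ - 1) π ≥ (k + 1)
  -- π`.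
  have hsr : s < k₀ * π / 2 := by
    rw [← (strictMonoOn_totalPhase hminus hplus).lt_iff_lt hs hr, hsk]
    linarith [(totalPhase_mem hminus hplus hr).1]
  obtain ⟨m1, m2⟩ := hminus.reflect.phase_mem_of_deriv hs hsr.le
    (BoundaryData.derivNonvanishing_reflect.mpr hm)
  obtain ⟨p1, p2⟩ := hplus.phase_mem_of_deriv hs hsr.le hp
  have htot : cminus.reflect.phase s + cplus.phase s = (k + 1) * π := hsk
  -- The two deviations `phase - s` add up to a number in `(-π, π)`, so `k π < 2 s < (k + 2) π`;
  -- this also gives both eigenvalue bounds.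
  have hs0 : 0 < s := by linarith
  refine ⟨s ^ 2, isNthEigenvalue_of_totalPhase hminus hplus hs hsk, fun ψ hψ => ?_, ?_, ?_⟩
  · obtain ⟨-, C, hC, hu⟩ := eigenfunction_eq_sin hminus hplus hs0 hψ
    refine mem_T_of_eqOn_sin hs0 hC hψ.contDiffOn hu ?_ ?_ ?_ ?_ <;> push_cast <;> linarith
  · exact pow_lt_pow_left₀ (by linarith) (by positivity) two_ne_zero
  · refine pow_lt_pow_left₀ ?_ hs two_ne_zero
    push_cast
    linarith

/-- The upper part of the spectrum, where the function does not vanish at the end points. -/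
theorem nthEigenvalue_of_valueNonvanishing (cminus cplus : BoundaryData)
    (hminus : cminus.Admissible (-1)) (hplus : cplus.Admissible 1) (k₀ : ℕ)
    (hm : cminus.ValueNonvanishing (eigenvalue dirichlet k₀))
    (hp : cplus.ValueNonvanishing (eigenvalue dirichlet k₀)) (k : ℕ) (hk : k₀ + 2 ≤ k) :
    ∃ lam : ℝ, IsNthEigenvalue (multiPoint cminus cplus) k lam ∧
      (∀ ψ : ℝ → ℝ, IsEigenfunction (multiPoint cminus cplus) lam ψ → ψ ∈ S k) ∧
      eigenvalue dirichlet (k - 2) < lam ∧ lam < eigenvalue dirichlet k := by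
  have hpi := pi_pos
  obtain ⟨s, hs, hsk⟩ := exists_totalPhase_eq hminus hplus k
  rw [eigenvalue_dirichlet] at hm hp
  rw [eigenvalue_dirichlet, eigenvalue_dirichlet, Nat.cast_sub (by lia)]
  have hr : 0 < ((k₀ : ℝ) + 1) * π / 2 := by positivity
  have hk2 : (k₀ : ℝ) + 2 ≤ k := by exact_mod_cast hk
  have hkk := mul_le_mul_of_nonneg_right hk2 hpi.le
  -- Here `k₀ + 2 ≤ k` enters: at `(k₀ + 1) π / 2` the total phase is still below `(k₀ + 3) π ≤ (k +
  -- 1) π`.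
  have hsr : ((k₀ : ℝ) + 1) * π / 2 < s := by
    rw [← (strictMonoOn_totalPhase hminus hplus).lt_iff_lt hr.le hs, hsk]
    linarith [(totalPhase_mem hminus hplus hr.le).2]
  obtain ⟨m1, m2⟩ := hminus.reflect.phase_mem_of_value hr hsr.le
    (BoundaryData.valueNonvanishing_reflect.mpr hm)
  obtain ⟨p1, p2⟩ := hplus.phase_mem_of_value hr hsr.le hp
  have htot : cminus.reflect.phase s + cplus.phase s = (k + 1) * π := hsk
  have hs0 : 0 < s := hr.trans hsr
  refine ⟨s ^ 2, isNthEigenvalue_of_totalPhase hminus hplus hs hsk, fun ψ hψ => ?_, ?_, ?_⟩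
  · obtain ⟨-, C, hC, hu⟩ := eigenfunction_eq_sin hminus hplus hs0 hψ
    -- The angle at `1` is minus the right deviation. At `-1` it is `-(k + 1) π` plus the left one,
    -- because the phases add up to `(k + 1) π`.
    refine mem_S_of_eqOn_sin hs0 hC hψ.contDiffOn hu ?_ ?_ ?_ ?_ <;> linarith
  · refine pow_lt_pow_left₀ ?_ ?_ two_ne_zero
    · push_cast
      linarith
    · have : (0 : ℝ) ≤ k - 2 + 1 := by linarith [(Nat.cast_nonneg k₀ : (0 : ℝ) ≤ k₀)]
      push_cast
      positivity
  · exact pow_lt_pow_left₀ (by linarith) hs two_ne_zero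

end MultiPoint

theorem mainTheorem1 (cminus cplus : MultiPoint.BoundaryData)
    (hminus : cminus.Admissible (-1)) (hplus : cplus.Admissible 1) (k₀ : ℕ) :
    (cminus.DerivNonvanishing (MultiPoint.eigenvalue MultiPoint.neumann k₀) →
      cplus.DerivNonvanishing (MultiPoint.eigenvalue MultiPoint.neumann k₀) →
      ∀ k : ℕ, k + 2 ≤ k₀ →
        ∃ lam : ℝ, MultiPoint.IsNthEigenvalue (MultiPoint.multiPoint cminus cplus) k lam ∧
          (∀ ψ : ℝ → ℝ,
            MultiPoint.IsEigenfunction (MultiPoint.multiPoint cminus cplus) lam ψ →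
              ψ ∈ MultiPoint.T (k + 1)) ∧
          MultiPoint.eigenvalue MultiPoint.neumann k < lam ∧
          lam < MultiPoint.eigenvalue MultiPoint.neumann (k + 2)) ∧
    (cminus.ValueNonvanishing (MultiPoint.eigenvalue MultiPoint.dirichlet k₀) →
      cplus.ValueNonvanishing (MultiPoint.eigenvalue MultiPoint.dirichlet k₀) →
      ∀ k : ℕ, k₀ + 2 ≤ k →
        ∃ lam : ℝ, MultiPoint.IsNthEigenvalue (MultiPoint.multiPoint cminus cplus) k lam ∧
          (∀ ψ : ℝ → ℝ,
            MultiPoint.IsEigenfunction (MultiPoint.multiPoint cminus cplus) lam ψ →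
              ψ ∈ MultiPoint.S k) ∧
          MultiPoint.eigenvalue MultiPoint.dirichlet (k - 2) < lam ∧
          lam < MultiPoint.eigenvalue MultiPoint.dirichlet k) :=
  ⟨MultiPoint.nthEigenvalue_of_derivNonvanishing cminus cplus hminus hplus k₀,
    MultiPoint.nthEigenvalue_of_valueNonvanishing cminus cplus hminus hplus k₀⟩
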